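/- **Theorem (Tractability of symmetric problems, absolute error).** Let $S_1\colon H_1\to G_1$ be a compact linear operator between two real Hilbert spaces, and let $\lambda_1\ge\lambda_2\ge\dots\ge 0$ be the eigenvalues of $W_1=S_1^\dagger S_1$ in non-increasing order: the positive eigenvalues, each repeated according to its multiplicity, followed by zeros if there are only finitely many of them. Assume $\lambda_2>0$ and $\lambda_1\le 1$. For $d\in\mathbb N=\{1,2,\dots\}$ let $H_d=H_1\otimes\dots\otimes H_1$ and $G_d=G_1\otimes\dots\otimes G_1$ be the $d$-fold Hilbert space tensor products, with $\langle\bigotimes_l f_l,\bigotimes_l g_l\rangle=\prod_l\langle f_l,g_l\rangle$, and let $S_d=S_1\otimes\dots\otimes S_1\colon H_d\to G_d$. Let $I_d\subset\{1,\dots,d\}$, with $I_d\ne\emptyset$ for $d>1$, let $\mathcal S_{I_d}$ be the set of all permutations of $\{1,\dots,d\}$ that fix every element outside $I_d$, and let $\mathfrak S_{I_d}$ be the symmetrizer, i.e. the continuous linear operator on $H_d$ with $\mathfrak S_{I_d}(\bigotimes_l f_l)=\frac1{\#\mathcal S_{I_d}}\sum_{\pi\in\mathcal S_{I_d}}\bigotimes_l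 f_{\pi(l)}$. The $I_d$-symmetric problem is the restriction of $S_d$ to $F_d=\mathfrak S_{I_d}(H_d)$. For $n\in\mathbb N_0$ let $$e(n,d)=\inf_{A}\ \sup_{f\in F_d,\ \|f\|\le 1}\|A(f)-S_d f\|_{G_d},$$ where the infimum is over all algorithms $A=\varphi\circ N$ with an arbitrary map $\varphi\colon\mathbb R^n\to G_d$ and $N(f)=(y_1,\dots,y_n)$, $y_v=L_v(f;y_1,\dots,y_{v-1})$, such that every $L_v(\,\cdot\,;y_1,\dots,y_{v-1})$ is a continuous linear functional on $F_d$, which may depend on the values $y_1,\dots,y_{v-1}$ obtained before. Let $n(\varepsilon,d)=\min\{n\in\mathbb N_0: e(n,d)\le\varepsilon\}$ be the information complexity. The problem is called *polynomially tractable* if there are $C,p>0$ and $q\ge0$ such that $n(\varepsilon,d)\le C\,\varepsilon^{-p}d^{\,q}$ for all $d\in\mathbb N$ and $\varepsilon\in(0,1]$, and *strongly polynomially tractable* if this holds with $q=0$. Then the $I_d$-symmetric problem is strongly polynomially tractable if and only if $\sum_m\lambda_m^\tau<\infty$ for some $\tau\in(0,\infty)$ and * $\lambda_1<1$, or * $\lambda_1=1>\lambda_2$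 and $d-\#I_d=O(1)$ as $d\to\infty$. Moreover, it is polynomially tractable if and only if $\sum_m\lambda_m^\tau<\infty$ for some $\tau\in(0,\infty)$ and * $\lambda_1<1$, or * $\lambda_1=1$ and $d-\#I_d=O(\ln d)$ as $d\to\infty$. -/

import Mathlib

open scoped TensorProduct ENNReal Asymptotics

noncomputable section

namespace TensorProblem

/-! ### The `d`-fold Hilbert space tensor power -/

/-- The algebraic `d`-fold tensor power of `H`: all finite linear combinations of simple tensors.
It is a copy of Mathlib's `⨂[ℝ] _ : Fin d, H`, on which the projective norm is not in force, so
that it can carry the Hilbert space inner product. -/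
def AlgPower (d : ℕ) (H : Type*) [NormedAddCommGroup H] [InnerProductSpace ℝ H] : Type _ :=
  ⨂[ℝ] _ : Fin d, H

section AlgPower

variable {d : ℕ} {H : Type*} [NormedAddCommGroup H] [InnerProductSpace ℝ H]
variable {G : Type*} [NormedAddCommGroup G] [InnerProductSpace ℝ G]

instance : AddCommGroup (AlgPower d H) :=
  inferInstanceAs (AddCommGroup (⨂[ℝ] _ : Fin d, H))

instance : Module ℝ (AlgPower d H) :=
  inferInstanceAs (Module ℝ (⨂[ℝ] _ : Fin d, H))

/-- The simple tensor `x 0 ⊗ ⋯ ⊗ x (d - 1)`. -/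
def AlgPower.tmul (x : Fin d → H) : AlgPower d H := PiTensorProduct.tprod ℝ x

/-- The bilinear form with `⟨⨂ xₗ, ⨂ yₗ⟩ = ∏ ⟨xₗ, yₗ⟩`. -/
def AlgPower.form (d : ℕ) (H : Type*) [NormedAddCommGroup H] [InnerProductSpace ℝ H] :
    AlgPower d H →ₗ[ℝ] AlgPower d H →ₗ[ℝ] ℝ :=
  (PiTensorProduct.dualDistrib (R := ℝ) (M := fun _ : Fin d => H)).comp
    (PiTensorProduct.map (fun _ : Fin d => innerₗ H))

theorem AlgPower.form_tmul (x y : Fin d → H) :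
    AlgPower.form d H (AlgPower.tmul x) (AlgPower.tmul y) = ∏ l, inner ℝ (x l) (y l) := by
  have h : PiTensorProduct.dualDistrib (R := ℝ) (M := fun _ : Fin d => H)
      (PiTensorProduct.map (fun _ : Fin d => innerₗ H) (PiTensorProduct.tprod ℝ x))
      (PiTensorProduct.tprod ℝ y) = ∏ l, inner ℝ (x l) (y l) := by
    rw [PiTensorProduct.map_tprod, PiTensorProduct.dualDistrib_apply]
    rfl
  exact h

theorem AlgPower.exists_eq_sum (t : AlgPower d H) :
    ∃ c : (Fin d → H) →₀ ℝ, c.sum (fun x a => a • AlgPower.tmul x) = t := by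
  have h (u : ⨂[ℝ] _ : Fin d, H) :
      ∃ c : (Fin d → H) →₀ ℝ, c.sum (fun x a => a • PiTensorProduct.tprod ℝ x) = u := by
    rw [← Finsupp.mem_span_range_iff_exists_finsupp, PiTensorProduct.span_tprod_eq_top]
    exact Submodule.mem_top
  exact h t

theorem AlgPower.induction {p : AlgPower d H → Prop} (h0 : p 0)
    (ht : ∀ (a : ℝ) (x : Fin d → H), p (a • AlgPower.tmul x))
    (hadd : ∀ s t, p s → p t → p (s + t)) (t : AlgPower d H) : p t := by
  obtain ⟨c, rfl⟩ := AlgPower.exists_eq_sum t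
  exact Finset.sum_induction _ p hadd h0 fun x _ => ht _ x

theorem AlgPower.hom_ext {E : Type*} [AddCommGroup E] [Module ℝ E] {f g : AlgPower d H →ₗ[ℝ] E}
    (h : ∀ x, f (AlgPower.tmul x) = g (AlgPower.tmul x)) : f = g := by
  ext t
  induction t using AlgPower.induction with
  | h0 => simp
  | ht a x => simp [h]
  | hadd s t hs ht => simp [hs, ht]

theorem AlgPower.form_symm (s t : AlgPower d H) :
    AlgPower.form d H s t = AlgPower.form d H t s := by
  have : AlgPower.form d H = (AlgPower.form d H).flip := by
    refine AlgPower.hom_ext fun x => AlgPower.hom_ext fun y => ?_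
    simp [AlgPower.form_tmul, real_inner_comm]
  exact DFunLike.congr_fun (DFunLike.congr_fun this s) t

/-- The Gram matrix of the simple tensors over a finite set of tensor factors. -/
def gramOn (H : Type*) [NormedAddCommGroup H] [InnerProductSpace ℝ H] {d : ℕ}
    (s : Finset (Fin d)) : Matrix (Fin d → H) (Fin d → H) ℝ :=
  Matrix.of fun x y => ∏ l ∈ s, inner ℝ (x l) (y l)

theorem gramOn_insert {s : Finset (Fin d)} {l : Fin d} (hl : l ∉ s) :
    gramOn H (insert l s) = (Matrix.gram ℝ fun x : Fin d → H => x l).hadamard (gramOn H s) := by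
  ext x y
  simp [gramOn, Finset.prod_insert hl, Matrix.gram]

theorem posSemidef_gram {ι : Type*} (v : ι → H) : (Matrix.gram ℝ v).PosSemidef := by
  refine ⟨Matrix.isHermitian_gram ℝ v, fun c => ?_⟩
  have h : (c.sum fun i a => c.sum fun j b => star a * Matrix.gram ℝ v i j * b) =
      inner ℝ (c.sum fun i a => a • v i) (c.sum fun i a => a • v i) := by
    simp only [Finsupp.sum, sum_inner, inner_sum, inner_smul_left, inner_smul_right,
      Matrix.gram_apply]
    refine Finset.sum_congr rfl fun i _ => ?_
    rw [Finset.mul_sum]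
    refine Finset.sum_congr rfl fun j _ => ?_
    simp only [star_trivial, conj_trivial, real_inner_comm]
    ring
  rw [h]
  exact real_inner_self_nonneg

theorem gramOn_posSemidef (s : Finset (Fin d)) : (gramOn H s).PosSemidef := by
  induction s using Finset.induction_on with
  | empty =>
    have : gramOn H (∅ : Finset (Fin d)) = Matrix.gram ℝ fun _ : Fin d → H => (1 : ℝ) := by
      ext x y; simp [gramOn, Matrix.gram]
    rw [this]
    exact posSemidef_gram _
  | insert l s hl ih =>
    rw [gramOn_insert hl]
    exact (posSemidef_gram _).hadamard ih

theorem AlgPower.form_sum_self (c : (Fin d → H) →₀ ℝ) :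
    AlgPower.form d H (c.sum fun x a => a • AlgPower.tmul x) (c.sum fun x a => a • AlgPower.tmul x)
      = c.sum fun x a => c.sum fun y b => star a * gramOn H Finset.univ x y * b := by
  simp only [Finsupp.sum, map_sum, LinearMap.sum_apply, map_smul, LinearMap.smul_apply,
    AlgPower.form_tmul, smul_eq_mul, gramOn, Matrix.of_apply, star_trivial]
  rw [Finset.sum_comm]
  refine Finset.sum_congr rfl fun x _ => ?_
  rw [Finset.mul_sum]
  refine Finset.sum_congr rfl fun y _ => ?_
  ring

theorem AlgPower.form_self_nonneg (t : AlgPower d H) : 0 ≤ AlgPower.form d H t t := by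
  obtain ⟨c, rfl⟩ := AlgPower.exists_eq_sum t
  rw [AlgPower.form_sum_self]
  exact (gramOn_posSemidef Finset.univ).2 c

instance AlgPower.core : PreInnerProductSpace.Core ℝ (AlgPower d H) where
  inner s t := AlgPower.form d H s t
  conj_inner_symm s t := AlgPower.form_symm t s
  re_inner_nonneg := AlgPower.form_self_nonneg
  add_left s t u := by simp
  smul_left s t a := by simp

instance : SeminormedAddCommGroup (AlgPower d H) :=
  InnerProductSpace.Core.toSeminormedAddCommGroup (𝕜 := ℝ)

instance : InnerProductSpace ℝ (AlgPower d H) := InnerProductSpace.ofCore AlgPower.core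

theorem AlgPower.inner_tmul (x y : Fin d → H) :
    inner ℝ (AlgPower.tmul x) (AlgPower.tmul y) = ∏ l, inner ℝ (x l) (y l) :=
  AlgPower.form_tmul x y

theorem AlgPower.norm_sq (t : AlgPower d H) : ‖t‖ ^ 2 = AlgPower.form d H t t :=
  (real_inner_self_eq_norm_sq t).symm

/-- The algebraic tensor power `S ⊗ ⋯ ⊗ S` of an operator. -/
def AlgPower.map (d : ℕ) (S : H →L[ℝ] G) : AlgPower d H →ₗ[ℝ] AlgPower d G :=
  PiTensorProduct.map (fun _ : Fin d => (S : H →ₗ[ℝ] G))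

theorem AlgPower.map_tmul (S : H →L[ℝ] G) (x : Fin d → H) :
    AlgPower.map d S (AlgPower.tmul x) = AlgPower.tmul fun l => S (x l) :=
  PiTensorProduct.map_tprod _ _

/-- Permutation of the tensor factors, `⨂ xₗ ↦ ⨂ x_{π(l)}`. -/
def AlgPower.perm (π : Equiv.Perm (Fin d)) : AlgPower d H →ₗ[ℝ] AlgPower d H :=
  (PiTensorProduct.reindex ℝ (fun _ : Fin d => H) π.symm).toLinearMap

theorem AlgPower.perm_tmul (π : Equiv.Perm (Fin d)) (x : Fin d → H) :
    AlgPower.perm π (AlgPower.tmul x) = AlgPower.tmul fun l => x (π l) :=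
  PiTensorProduct.reindex_tprod _ _

theorem gramOn_map_posSemidef (S : H →L[ℝ] G) (s : Finset (Fin d)) :
    ((‖S‖ ^ 2) ^ s.card • gramOn H s -
      (gramOn G s).submatrix (fun (x : Fin d → H) l => S (x l)) (fun (x : Fin d → H) l => S (x l))).PosSemidef := by
  induction s using Finset.induction_on with
  | empty =>
    convert Matrix.PosSemidef.zero using 1
    ext x y; simp [gramOn]
  | insert l s hl ih =>
    have h1 := (Matrix.posSemidef_opNorm_smul_gram_sub_gram (fun x : Fin d → H => x l) S).hadamard
      ((gramOn_posSemidef (H := H) s).smul (pow_nonneg (sq_nonneg ‖S‖) s.card))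
    have h2 := (posSemidef_gram fun x : Fin d → H => S (x l)).hadamard ih
    have h3 : (‖S‖ ^ 2) ^ (insert l s).card • gramOn H (insert l s) -
        (gramOn G (insert l s)).submatrix (fun (x : Fin d → H) l => S (x l))
          (fun (x : Fin d → H) l => S (x l)) =
        (‖S‖ ^ 2 • (Matrix.gram ℝ fun x : Fin d → H => x l) -
          Matrix.gram ℝ (S ∘ fun x : Fin d → H => x l)).hadamard
            ((‖S‖ ^ 2) ^ s.card • gramOn H s) +
        (Matrix.gram ℝ fun x : Fin d → H => S (x l)).hadamard
          ((‖S‖ ^ 2) ^ s.card • gramOn H s - (gramOn G s).submatrix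
            (fun (x : Fin d → H) l => S (x l)) (fun (x : Fin d → H) l => S (x l))) := by
      ext x y
      simp [gramOn, Finset.prod_insert hl, Finset.card_insert_of_notMem hl, Matrix.gram]
      ring
    rw [h3]
    exact h1.add h2

theorem AlgPower.norm_map_le (S : H →L[ℝ] G) (t : AlgPower d H) :
    ‖AlgPower.map d S t‖ ≤ ‖S‖ ^ d * ‖t‖ := by
  refine (sq_le_sq₀ (norm_nonneg _) (by positivity)).1 ?_
  rw [mul_pow, ← pow_mul, mul_comm d 2, pow_mul, AlgPower.norm_sq, AlgPower.norm_sq]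
  obtain ⟨c, rfl⟩ := AlgPower.exists_eq_sum t
  have h := (gramOn_map_posSemidef S (Finset.univ : Finset (Fin d))).2 c
  have h1 : AlgPower.form d G (AlgPower.map d S (c.sum fun x a => a • AlgPower.tmul x))
      (AlgPower.map d S (c.sum fun x a => a • AlgPower.tmul x)) =
      c.sum fun x a => c.sum fun y b => star a * (gramOn G Finset.univ).submatrix
        (fun (x : Fin d → H) l => S (x l)) (fun (x : Fin d → H) l => S (x l)) x y * b := by
    simp only [Finsupp.sum, map_sum, LinearMap.sum_apply, map_smul, LinearMap.smul_apply,
      AlgPower.map_tmul, AlgPower.form_tmul, smul_eq_mul, gramOn, Matrix.of_apply, star_trivial,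
      Matrix.submatrix_apply]
    rw [Finset.sum_comm]
    refine Finset.sum_congr rfl fun x _ => ?_
    rw [Finset.mul_sum]
    refine Finset.sum_congr rfl fun y _ => ?_
    ring
  rw [h1, AlgPower.form_sum_self]
  rw [← sub_nonneg]
  refine h.trans_eq ?_
  simp only [Finsupp.sum, Finset.mul_sum, ← Finset.sum_sub_distrib, Matrix.sub_apply,
    Matrix.smul_apply, smul_eq_mul, Finset.card_univ, Fintype.card_fin]
  refine Finset.sum_congr rfl fun x _ => Finset.sum_congr rfl fun y _ => ?_
  ring

theorem AlgPower.norm_perm (π : Equiv.Perm (Fin d)) (t : AlgPower d H) :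
    ‖AlgPower.perm π t‖ = ‖t‖ := by
  have : (AlgPower.form d H).compl₁₂ (AlgPower.perm π) (AlgPower.perm π) = AlgPower.form d H := by
    refine AlgPower.hom_ext fun x => AlgPower.hom_ext fun y => ?_
    simp only [LinearMap.compl₁₂_apply, AlgPower.perm_tmul, AlgPower.form_tmul]
    exact Equiv.prod_comp π fun l => inner ℝ (x l) (y l)
  have h : ‖AlgPower.perm π t‖ ^ 2 = ‖t‖ ^ 2 := by
    rw [AlgPower.norm_sq, AlgPower.norm_sq]
    exact DFunLike.congr_fun (DFunLike.congr_fun this t) t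
  exact (pow_left_inj₀ (norm_nonneg _) (norm_nonneg _) two_ne_zero).1 h

end AlgPower

/-- The Hilbert space tensor power `H ⊗ ⋯ ⊗ H` (`d` factors): the completion of the algebraic
tensor power with respect to `⟨⨂ xₗ, ⨂ yₗ⟩ = ∏ ⟨xₗ, yₗ⟩`. -/
abbrev HilbertPower (d : ℕ) (H : Type*) [NormedAddCommGroup H] [InnerProductSpace ℝ H] : Type _ :=
  UniformSpace.Completion (AlgPower d H)

section HilbertPower

variable {d : ℕ} {H : Type*} [NormedAddCommGroup H] [InnerProductSpace ℝ H]
variable {G : Type*} [NormedAddCommGroup G] [InnerProductSpace ℝ G]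

/-- The simple tensor `x 0 ⊗ ⋯ ⊗ x (d - 1)` in the Hilbert space tensor power. -/
def pureTensor (x : Fin d → H) : HilbertPower d H := (AlgPower.tmul x : AlgPower d H)

theorem inner_pureTensor (x y : Fin d → H) :
    inner ℝ (pureTensor x) (pureTensor y) = ∏ l, inner ℝ (x l) (y l) := by
  rw [pureTensor, pureTensor, UniformSpace.Completion.inner_coe, AlgPower.inner_tmul]

/-- The tensor product operator `S ⊗ ⋯ ⊗ S`, extended to the completion by continuity. -/
def tensorOp (d : ℕ) (S : H →L[ℝ] G) : HilbertPower d H →L[ℝ] HilbertPower d G :=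
  ((AlgPower.map d S).mkContinuous (‖S‖ ^ d) (AlgPower.norm_map_le S)).completion

theorem tensorOp_pureTensor (S : H →L[ℝ] G) (x : Fin d → H) :
    tensorOp d S (pureTensor x) = pureTensor fun l => S (x l) := by
  simp only [tensorOp, pureTensor, ContinuousLinearMap.completion_apply_coe]
  exact congrArg _ (AlgPower.map_tmul S x)

/-- Permutation of the tensor factors, `⨂ xₗ ↦ ⨂ x_{π(l)}`, on the Hilbert space tensor power. -/
def permOp (π : Equiv.Perm (Fin d)) : HilbertPower d H →L[ℝ] HilbertPower d H :=
  ((AlgPower.perm π).mkContinuous 1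
    (fun t => by rw [one_mul]; exact (AlgPower.norm_perm π t).le)).completion

theorem permOp_pureTensor (π : Equiv.Perm (Fin d)) (x : Fin d → H) :
    permOp π (pureTensor x) = pureTensor fun l => x (π l) := by
  simp only [permOp, pureTensor, ContinuousLinearMap.completion_apply_coe]
  exact congrArg _ (AlgPower.perm_tmul π x)

/-- The permutations of the coordinates that leave the complement of `I` fixed. -/
def permsOn (I : Finset (Fin d)) : Finset (Equiv.Perm (Fin d)) :=
  Finset.univ.filter fun π => ∀ l, l ∉ I → π l = l

/-- The symmetrizer with respect to `I`: the average over all permutations of the tensor factors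
in `I`. -/
def symmetrizer (H : Type*) [NormedAddCommGroup H] [InnerProductSpace ℝ H] (I : Finset (Fin d)) :
    HilbertPower d H →L[ℝ] HilbertPower d H :=
  ((permsOn I).card : ℝ)⁻¹ • ∑ π ∈ permsOn I, permOp π

/-- The subspace of `I`-symmetric elements of the tensor power, the image of the symmetrizer. -/
def symSubspace (H : Type*) [NormedAddCommGroup H] [InnerProductSpace ℝ H] (I : Finset (Fin d)) :
    Submodule ℝ (HilbertPower d H) :=
  (symmetrizer H I).range

/-- The `I`-symmetric problem: `S ⊗ ⋯ ⊗ S` restricted to the `I`-symmetric subspace. -/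
def symProblem (S : H →L[ℝ] G) (I : Finset (Fin d)) : symSubspace H I →L[ℝ] HilbertPower d G :=
  (tensorOp d S).comp (symSubspace H I).subtypeL

end HilbertPower

/-! ### Algorithms, minimal errors and information complexity -/

section Complexity

variable {F : Type*} [NormedAddCommGroup F] [NormedSpace ℝ F]
variable {G : Type*} [NormedAddCommGroup G] [NormedSpace ℝ G]

/-- An adaptive information operator: `L v y` is the continuous linear functional that is evaluated
in step `v + 1`, after the values `y 0, …, y (v - 1)` have been obtained. -/
abbrev AdaptiveInfo (F : Type*) [NormedAddCommGroup F] [NormedSpace ℝ F] : Type _ :=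
  (v : ℕ) → (Fin v → ℝ) → (F →L[ℝ] ℝ)

/-- The first `n` values `N(f) = (y 0, …, y (n - 1))` that adaptive information yields at `f`. -/
def AdaptiveInfo.eval (L : AdaptiveInfo F) (f : F) : (n : ℕ) → (Fin n → ℝ)
  | 0 => Fin.elim0
  | n + 1 => Fin.snoc (α := fun _ => ℝ) (L.eval f n) (L n (L.eval f n) f)

/-- The worst case error on the unit ball of an arbitrary map `A` as approximation of `T`. -/
def worstCaseError (T : F →L[ℝ] G) (A : F → G) : ℝ≥0∞ :=
  ⨆ f ∈ Metric.closedBall (0 : F) 1, ‖A f - T f‖ₑ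

/-- The `n`-th minimal worst case error: the infimum over all algorithms `φ ∘ N` where `N` consists
of `n` adaptively chosen continuous linear functionals and `φ` is an arbitrary map. -/
def minimalError (T : F →L[ℝ] G) (n : ℕ) : ℝ≥0∞ :=
  ⨅ (L : AdaptiveInfo F) (φ : (Fin n → ℝ) → G), worstCaseError T fun f => φ (L.eval f n)

/-- The information complexity `n(ε) = min {n | e(n) ≤ ε}` for the absolute error criterion
(`⊤` if there is no such `n`). -/
def infoComplexity (T : F →L[ℝ] G) (ε : ℝ) : ℕ∞ :=
  ⨅ (n : ℕ) (_ : minimalError T n ≤ ENNReal.ofReal ε), (n : ℕ∞)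

/-- `n(ε, d) ≤ C ε⁻ᵖ d^q` for all `d ≥ 1` and `ε ∈ (0, 1]`. -/
def TractabilityBound (n : ℝ → ℕ → ℕ∞) (C p q : ℝ) : Prop :=
  ∀ d : ℕ, 1 ≤ d → ∀ ε : ℝ, 0 < ε → ε ≤ 1 →
    (n ε d : ℝ≥0∞) ≤ ENNReal.ofReal (C * ε ^ (-p) * (d : ℝ) ^ q)

/-- Polynomial tractability of a problem with information complexity `n(ε, d)`. -/
def PolynomiallyTractable (n : ℝ → ℕ → ℕ∞) : Prop :=
  ∃ C p q : ℝ, 0 < C ∧ 0 < p ∧ 0 ≤ q ∧ TractabilityBound n C p q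

/-- Strong polynomial tractability of a problem with information complexity `n(ε, d)`. -/
def StronglyPolynomiallyTractable (n : ℝ → ℕ → ℕ∞) : Prop :=
  ∃ C p : ℝ, 0 < C ∧ 0 < p ∧ TractabilityBound n C p 0

end Complexity

/-- `lam 0 ≥ lam 1 ≥ ⋯ ≥ 0` lists the positive eigenvalues of `W`, each one as often as its
multiplicity says, followed by zeros if there are only finitely many of them. -/
structure IsEigenvalueSeq {H : Type*} [NormedAddCommGroup H] [InnerProductSpace ℝ H]
    (W : H →L[ℝ] H) (lam : ℕ → ℝ) : Prop where
  antitone : Antitone lam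
  nonneg : ∀ m, 0 ≤ lam m
  count : ∀ μ : ℝ, 0 < μ → {m | lam m = μ}.encard =
    Cardinal.toENat (Module.rank ℝ (Module.End.eigenspace (W : H →ₗ[ℝ] H) μ))

end TensorProblem

end

open scoped TensorProduct ENNReal Asymptotics

noncomputable section

namespace TensorProblem

/-! ### Diagonalization of a compact operator -/

section Spectral

universe u

/-! An eigenbasis `b i` of `S†S` with eigenvalues `mu i` makes the tensors `⨂ b (j l)` a Hilbert
basis that diagonalizes `S_d`, with squared singular values `∏ mu (j l)`. On the symmetric subspace
the coefficients are constant along orbits of tuples under `permsOn I`. Hence `n(ε, d)` counts the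
orbits of weight above `ε²`. Adaption cannot help, because some `f` and `-f` give the same zero data
(`infoComplexity_symProblem_le`, `card_le_infoComplexity_symProblem`).

Upper bound (`infoComplexity_symProblem_le_rpow`): an orbit is coded by its multiplicities on `I`
and its entries off `I`. By Chebyshev's inequality the count is at most `ε^(-2τ)` times the sum of
the `τ`-th powers of the weights, and over codes this sum is dominated by geometric factors times
`(∑ mu ^ τ) ^ (d - #I)`. After enlarging `τ`, the eigenvalues below `1` contribute a factor at most
`2`. Each eigenvalue `1` contributes `d + 1`, except that one multiplicity is determined by the
others and costs nothing.

Lower bound (`sum_rpow_le_of_infoComplexity_le`): a bound `K ε^(-p)` on the count bounds the sum of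
the weights to the power `p / 2 + 1` over inequivalent tuples. Dimension one gives summability. If
`mu i₀ = 1`, tuples with entries `i₀, i₁` that vary off `I` bound `(1 + mu i₁ ^ (p / 2 + 1)) ^ (d -
#I)`. If also `mu i₁ = 1`, varying them on `I` bounds `#I + 1`. -/

theorem exists_equiv_of_fiber_equiv {α α' β : Type*} (f : α → β) (g : α' → β)
    (h : ∀ r, Nonempty ({a // f a = r} ≃ {a // g a = r})) :
    ∃ φ : α ≃ α', ∀ a, g (φ a) = f a := by
  let e (r : β) := (h r).some
  refine ⟨(Equiv.sigmaFiberEquiv f).symm.trans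
    ((Equiv.sigmaCongrRight e).trans (Equiv.sigmaFiberEquiv g)), fun a => ?_⟩
  exact (e (f a) ⟨a, rfl⟩).2

theorem finite_and_card_hilbertBasis_index {ι E : Type*} [NormedAddCommGroup E]
    [InnerProductSpace ℝ E] [FiniteDimensional ℝ E] (b : HilbertBasis ι ℝ E) :
    Finite ι ∧ ENat.card ι = Cardinal.toENat (Module.rank ℝ E) := by
  have hfin : Finite ι := b.orthonormal.linearIndependent.finite
  have := Fintype.ofFinite ι
  refine ⟨hfin, ?_⟩
  rw [rank_eq_card_basis b.toOrthonormalBasis.toBasis]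
  simp

/-- Hilbert bases of all eigenspaces, the kernel included, are put together. The spectral theorem
for compact self-adjoint operators makes the union complete, and nonzero eigenvalues have
finite-dimensional eigenspaces. -/
theorem exists_eigenbasis {H : Type u} [NormedAddCommGroup H] [InnerProductSpace ℝ H]
    [CompleteSpace H] (W : H →L[ℝ] H) (hW : IsCompactOperator W)
    (hsymm : (W : H →ₗ[ℝ] H).IsSymmetric) :
    ∃ (ι : Type u) (b : HilbertBasis ι ℝ H) (mu : ι → ℝ), (∀ i, W (b i) = mu i • b i) ∧
      ∀ r, r ≠ 0 → Finite {i // mu i = r} ∧ ENat.card {i // mu i = r} =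
        Cardinal.toENat (Module.rank ℝ (Module.End.eigenspace (W : H →ₗ[ℝ] H) r)) := by
  have hclosed (r : ℝ) : IsClosed
      ((Module.End.eigenspace (W : H →ₗ[ℝ] H) r : Submodule ℝ H) : Set H) := by
    have : ((Module.End.eigenspace (W : H →ₗ[ℝ] H) r : Submodule ℝ H) : Set H) =
        {x | W x = r • x} := by
      ext x; simp
    rw [this]
    exact isClosed_eq W.continuous (continuous_const_smul r)
  have hcomplete (r : ℝ) : CompleteSpace (Module.End.eigenspace (W : H →ₗ[ℝ] H) r) :=
    (hclosed r).completeSpace_coe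
  choose w c hc using fun r : ℝ =>
    exists_hilbertBasis ℝ (Module.End.eigenspace (W : H →ₗ[ℝ] H) r)
  have hv : Orthonormal ℝ fun a : Σ r, w r => ((c a.1 a.2 : _) : H) := hsymm.orthogonalFamily_eigenspaces.orthonormal_sigma_orthonormal
    (v_family := fun r => (c r)) (fun r => (c r).orthonormal)
  have hperp : (Submodule.span ℝ (Set.range fun a : Σ r, w r => ((c a.1 a.2 : _) : H)))ᗮ = ⊥ := by
    rw [eq_bot_iff,
      ← ContinuousLinearMap.orthogonalComplement_iSup_eigenspaces_eq_bot hW hsymm]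
    intro y hy
    rw [← Submodule.iInf_orthogonal]
    simp only [Submodule.mem_iInf]
    intro r
    rw [Submodule.mem_orthogonal]
    intro x hx
    have hz : (Module.End.eigenspace (W : H →ₗ[ℝ] H) r).orthogonalProjectionOnto y = 0 := by
      have h0 (i) : inner ℝ (c r i)
          ((Module.End.eigenspace (W : H →ₗ[ℝ] H) r).orthogonalProjectionOnto y) = 0 := by
        rw [Submodule.inner_orthogonalProjectionOnto_eq_of_mem_left]
        exact (Submodule.mem_orthogonal _ _).1 hy _ (Submodule.subset_span ⟨⟨r, i⟩, rfl⟩)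
      have := (c r).hasSum_repr
        ((Module.End.eigenspace (W : H →ₗ[ℝ] H) r).orthogonalProjectionOnto y)
      simp only [(c r).repr_apply_apply, h0, zero_smul] at this
      exact this.unique hasSum_zero
    have := Submodule.inner_orthogonalProjectionOnto_eq_of_mem_left (⟨x, hx⟩ :
      Module.End.eigenspace (W : H →ₗ[ℝ] H) r) y
    rw [hz, inner_zero_right] at this
    exact this.symm
  refine ⟨Σ r, w r, HilbertBasis.mkOfOrthogonalEqBot hv hperp, fun a => a.1, ?_, ?_⟩
  · intro a
    rw [HilbertBasis.coe_mkOfOrthogonalEqBot]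
    exact Module.End.mem_eigenspace_iff.1 (c a.1 a.2).2
  · intro r hr
    have := ContinuousLinearMap.finite_dimensional_eigenspace hW r hr
    obtain ⟨h1, h2⟩ := finite_and_card_hilbertBasis_index (c r)
    exact ⟨Finite.of_equiv _ (Equiv.sigmaSubtype r).symm,
      (ENat.card_congr (Equiv.sigmaSubtype r)).trans h2⟩

/-- A compact operator is diagonalized by a Hilbert basis, with the given singular values. -/
theorem exists_singular_basis {H : Type u} {G : Type*}
    [NormedAddCommGroup H] [InnerProductSpace ℝ H] [CompleteSpace H]
    [NormedAddCommGroup G] [InnerProductSpace ℝ G] [CompleteSpace G]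
    (S : H →L[ℝ] G) (hS : IsCompactOperator S)
    (lam : ℕ → ℝ) (hlam : IsEigenvalueSeq (S.adjoint ∘L S) lam) :
    ∃ (ι : Type u) (b : HilbertBasis ι ℝ H) (mu : ι → ℝ), (∀ i, 0 ≤ mu i) ∧
      (∀ i, inner ℝ (S (b i)) (S (b i)) = mu i) ∧
      (∀ i j, i ≠ j → inner ℝ (S (b i)) (S (b j)) = 0) ∧
      ∃ φ : {i // 0 < mu i} ≃ {m // 0 < lam m}, ∀ i, lam (φ i) = mu i := by
  obtain ⟨ι, b, mu, hb, hcard⟩ := exists_eigenbasis (S.adjoint ∘L S) (hS.clm_comp S.adjoint) (by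
    intro x y
    simp [ContinuousLinearMap.adjoint_inner_left, ContinuousLinearMap.adjoint_inner_right])
  have hinner (i j) : inner ℝ (S (b i)) (S (b j)) = mu i * inner ℝ (b i) (b j) := by
    rw [← ContinuousLinearMap.adjoint_inner_left]
    have := hb i
    simp only [ContinuousLinearMap.comp_apply] at this
    rw [this, inner_smul_left]; simp
  have hself (i) : inner ℝ (S (b i)) (S (b i)) = mu i := by
    rw [hinner, real_inner_self_eq_norm_sq, b.orthonormal.1 i]; simp
  refine ⟨ι, b, mu, fun i => hself i ▸ real_inner_self_nonneg, hself, ?_, ?_⟩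
  · intro i j hij
    rw [hinner, b.orthonormal.2 hij, mul_zero]
  -- Over each `r > 0` both fibres have the finite multiplicity of `r` as cardinality. Zeros are
  -- left out, as the dimension of the kernel need not match the number of zeros in `lam`.
  · obtain ⟨φ, hφ⟩ := exists_equiv_of_fiber_equiv (fun i : {i // 0 < mu i} => mu i)
      (fun m : {m // 0 < lam m} => lam m) (by
        intro r
        rcases le_or_gt r 0 with hr | hr
        · have h1 : IsEmpty {a : {i // 0 < mu i} // mu a = r} := ⟨fun a => by
            have := a.1.2; have := a.2; linarith⟩
          have h2 : IsEmpty {a : {m // 0 < lam m} // lam a = r} := ⟨fun a => by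
            have := a.1.2; have := a.2; linarith⟩
          exact ⟨Equiv.equivOfIsEmpty _ _⟩
        · obtain ⟨hfin, hc⟩ := hcard r hr.ne'
          have hcount := hlam.count r hr
          rw [← hc] at hcount
          have e1 : {a : {i // 0 < mu i} // mu a = r} ≃ {i // mu i = r} :=
            Equiv.subtypeSubtypeEquivSubtype (p := fun i => 0 < mu i) (q := fun i => mu i = r)
              (fun h => h ▸ hr)
          have e2 : {a : {m // 0 < lam m} // lam a = r} ≃ {m // lam m = r} :=
            Equiv.subtypeSubtypeEquivSubtype (p := fun i => 0 < lam i) (q := fun i => lam i = r)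
              (fun h => h ▸ hr)
          have hcount' : ENat.card {m // lam m = r} = ENat.card {i // mu i = r} := hcount
          have hfin2 : Finite {m // lam m = r} := by
            rw [← ENat.card_lt_top, hcount', ENat.card_lt_top]; exact hfin
          have := Fintype.ofFinite {i // mu i = r}
          have := Fintype.ofFinite {m // lam m = r}
          rw [ENat.card_eq_coe_fintype_card, ENat.card_eq_coe_fintype_card, Nat.cast_inj] at hcount'
          exact ⟨e1.trans ((Fintype.equivOfCardEq hcount'.symm).trans e2.symm)⟩)
    exact ⟨φ, hφ⟩

end Spectral

/-! ### Bounds for the minimal error of operators on inner product spaces -/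

section MinimalError

theorem AdaptiveInfo.eval_nonadaptive {F : Type*} [NormedAddCommGroup F] [NormedSpace ℝ F]
    (ℓ : ℕ → F →L[ℝ] ℝ) (f : F) (n : ℕ) (i : Fin n) :
    AdaptiveInfo.eval (fun v _ => ℓ v) f n i = ℓ i f := by
  induction n with
  | zero => exact i.elim0
  | succ n ih =>
    rw [AdaptiveInfo.eval]
    refine Fin.lastCases ?_ (fun i => ?_) i
    · simp
    · simp [ih i]

/-- While all answers are zero, the adaptive choice is forced to be `L v 0`. On such inputs the
information is therefore given by `n` fixed functionals. -/
theorem AdaptiveInfo.eval_eq_zero {F : Type*} [NormedAddCommGroup F] [NormedSpace ℝ F]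
    (L : AdaptiveInfo F) (f : F) (n : ℕ) (h : ∀ v < n, L v 0 f = 0) :
    L.eval f n = 0 := by
  induction n with
  | zero => exact Subsingleton.elim _ _
  | succ n ih =>
    rw [AdaptiveInfo.eval, ih fun v hv => h v (hv.trans n.lt_succ_self), h n n.lt_succ_self]
    ext i
    refine Fin.lastCases ?_ (fun i => ?_) i <;> simp

variable {F : Type*} [NormedAddCommGroup F] [InnerProductSpace ℝ F]
variable {G : Type*} [NormedAddCommGroup G] [NormedSpace ℝ G]

/-- The algorithm returns `T g` for some `g` in the span of the `v i` with the same data as `f`.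
Then `f - g` is orthogonal to that span, so Pythagoras gives `‖f - g‖ ≤ 1`. -/
theorem minimalError_le_of_orthogonal (T : F →L[ℝ] G) {ε : ℝ} (hε : 0 ≤ ε) (n : ℕ) (v : ℕ → F)
    (h : ∀ f, (∀ i < n, inner ℝ (v i) f = 0) → ‖T f‖ ≤ ε * ‖f‖) :
    minimalError T n ≤ ENNReal.ofReal ε := by
  classical
  let V : Submodule ℝ F := Submodule.span ℝ (v '' Set.Iio n)
  have hV : FiniteDimensional ℝ V := FiniteDimensional.span_of_finite ℝ ((Set.finite_Iio n).image v)
  -- The value `0` is never used on actual data, since the projection of `f` to `V` is an admissible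
  -- `g`.
  let φ : (Fin n → ℝ) → G := fun y =>
    if hy : ∃ g ∈ V, ∀ i : Fin n, inner ℝ (v i) g = y i then T hy.choose else 0
  refine (iInf₂_le (fun m _ => innerSL ℝ (v m)) φ).trans ?_
  refine iSup₂_le fun f hf => ?_
  have hy : ∃ g ∈ V, ∀ i : Fin n, inner ℝ (v i) g =
      AdaptiveInfo.eval (fun m _ => innerSL ℝ (v m)) f n i := by
    refine ⟨V.orthogonalProjectionOnto f, Submodule.coe_mem _, fun i => ?_⟩
    rw [AdaptiveInfo.eval_nonadaptive, innerSL_apply_apply]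
    exact Submodule.inner_orthogonalProjectionOnto_eq_of_mem_left
      (⟨v i, Submodule.subset_span ⟨i, i.2, rfl⟩⟩ : V) f
  have hφ : φ (AdaptiveInfo.eval (fun m _ => innerSL ℝ (v m)) f n) = T hy.choose := dif_pos hy
  simp only [hφ]
  obtain ⟨hg, hgv⟩ := hy.choose_spec
  set g := hy.choose
  have hortho : ∀ i < n, inner ℝ (v i) (f - g) = 0 := by
    intro i hi
    have := hgv ⟨i, hi⟩
    rw [AdaptiveInfo.eval_nonadaptive, innerSL_apply_apply] at this
    simp only at this
    rw [inner_sub_right, this, sub_self]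
  have hgf : inner ℝ g (f - g) = 0 := by
    have hle : V ≤ (Submodule.span ℝ {f - g})ᗮ := by
      rw [Submodule.span_le]
      rintro _ ⟨i, hi, rfl⟩
      rw [SetLike.mem_coe, Submodule.mem_orthogonal_singleton_iff_inner_left]
      exact hortho i hi
    exact (Submodule.mem_orthogonal_singleton_iff_inner_left).1 (hle hg)
  have hnorm : ‖f - g‖ ≤ 1 := by
    have hpyth := norm_add_sq_eq_norm_sq_add_norm_sq_of_inner_eq_zero g (f - g) hgf
    rw [add_sub_cancel] at hpyth
    have hf1 : ‖f‖ ≤ 1 := by simpa using hf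
    nlinarith [norm_nonneg f, norm_nonneg (f - g), norm_nonneg g]
  rw [← map_sub, ← ofReal_norm]
  refine ENNReal.ofReal_le_ofReal ?_
  rw [← norm_neg, ← map_neg, neg_sub]
  exact (h _ hortho).trans (by nlinarith)

/-- By dimension, the `n` functionals `L v 0` have a common zero `f` of norm one in the range of
`Φ`. Both `f` and `-f` yield the data `0`, so `φ 0` has to approximate two points at distance `2‖T
f‖ ≥ 2c`. -/
theorem le_minimalError_of_linearMap (T : F →L[ℝ] G) {c : ℝ} (n : ℕ) {κ : Type*}
    [Fintype κ] (Φ : (κ → ℝ) →ₗ[ℝ] F) (hΦ : Function.Injective Φ)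
    (hT : ∀ x, c * ‖Φ x‖ ≤ ‖T (Φ x)‖) (hn : n < Fintype.card κ) :
    ENNReal.ofReal c ≤ minimalError T n := by
  refine le_iInf₂ fun L φ => ?_
  let N : (κ → ℝ) →ₗ[ℝ] (Fin n → ℝ) :=
    LinearMap.pi fun v => ((L v 0 : F →L[ℝ] ℝ) : F →ₗ[ℝ] ℝ) ∘ₗ Φ
  have hker : LinearMap.ker N ≠ ⊥ := LinearMap.ker_ne_bot_of_finrank_lt (by simpa using hn)
  obtain ⟨x, hxN, hx0⟩ := Submodule.exists_mem_ne_zero_of_ne_bot hker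
  have hf0 : Φ x ≠ 0 := fun h => hx0 (hΦ (by rw [h, map_zero]))
  have hpos : 0 < ‖Φ x‖ := norm_pos_iff.2 hf0
  set f : F := ‖Φ x‖⁻¹ • Φ x
  have hf1 : ‖f‖ = 1 := by rw [norm_smul, norm_inv, norm_norm, inv_mul_cancel₀ hpos.ne']
  have hL : ∀ v < n, L v 0 f = 0 := by
    intro v hv
    have : N x ⟨v, hv⟩ = 0 := by rw [LinearMap.mem_ker.1 hxN]; rfl
    have h' : L v 0 (Φ x) = 0 := this
    rw [map_smul, h', smul_zero]
  have hTf : c ≤ ‖T f‖ := by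
    rw [map_smul, norm_smul, norm_inv, norm_norm, inv_mul_eq_div, le_div_iff₀ hpos]
    exact hT x
  have e1 : L.eval f n = 0 := L.eval_eq_zero f n hL
  have e2 : L.eval (-f) n = 0 := L.eval_eq_zero (-f) n fun v hv => by rw [map_neg, hL v hv, neg_zero]
  have b1 : ‖φ 0 - T f‖ₑ ≤ worstCaseError T fun f => φ (L.eval f n) := by
    have := le_iSup₂ (f := fun (g : F) (_ : g ∈ Metric.closedBall (0 : F) 1) =>
      ‖φ (L.eval g n) - T g‖ₑ) f (by simp [hf1])
    rwa [e1] at this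
  have b2 : ‖φ 0 - T (-f)‖ₑ ≤ worstCaseError T fun f => φ (L.eval f n) := by
    have := le_iSup₂ (f := fun (g : F) (_ : g ∈ Metric.closedBall (0 : F) 1) =>
      ‖φ (L.eval g n) - T g‖ₑ) (-f) (by simp [hf1])
    rwa [e2] at this
  have hmax : c ≤ max ‖φ 0 - T f‖ ‖φ 0 - T (-f)‖ := by
    have : ‖(2 : ℝ) • T f‖ ≤ ‖φ 0 - T f‖ + ‖φ 0 - T (-f)‖ := by
      rw [← norm_sub_rev]
      refine le_trans (le_of_eq ?_) (norm_add_le _ _)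
      congr 1
      rw [map_neg, two_smul]; abel
    rw [norm_smul] at this
    norm_num at this
    rcases le_total ‖φ 0 - T f‖ ‖φ 0 - T (-f)‖ with h | h
    · rw [max_eq_right h]; rw [map_neg, sub_neg_eq_add] at *; linarith
    · rw [max_eq_left h]; rw [map_neg, sub_neg_eq_add] at *; linarith
  rcases le_max_iff.1 hmax with h | h
  · exact (ENNReal.ofReal_le_ofReal h).trans ((ofReal_norm _).le.trans b1)
  · exact (ENNReal.ofReal_le_ofReal h).trans ((ofReal_norm _).le.trans b2)

theorem infoComplexity_le {T : F →L[ℝ] G} {ε : ℝ} {n : ℕ}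
    (h : minimalError T n ≤ ENNReal.ofReal ε) : infoComplexity T ε ≤ n :=
  iInf₂_le n h

theorem le_infoComplexity {T : F →L[ℝ] G} {ε c : ℝ} {N : ℕ} (hε : 0 ≤ ε) (hc : ε < c)
    (h : ∀ n < N, ENNReal.ofReal c ≤ minimalError T n) : (N : ℕ∞) ≤ infoComplexity T ε := by
  refine le_iInf₂ fun n hn => ?_
  by_contra! hlt
  have h1 := (h n (by exact_mod_cast hlt)).trans hn
  rw [ENNReal.ofReal_le_ofReal_iff hε] at h1
  linarith

end MinimalError

/-! ### Hilbert bases of tensor powers and the symmetrizer -/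

/-- Parseval's identity for `T`: expand `f` in the basis and pair with `T f`. Orthogonality of the
images leaves a single term in each coefficient. -/
theorem hasSum_mul_inner_sq {ι E G : Type*} [NormedAddCommGroup E] [InnerProductSpace ℝ E]
    [NormedAddCommGroup G] [InnerProductSpace ℝ G] (b : HilbertBasis ι ℝ E) (T : E →L[ℝ] G)
    (w : ι → ℝ) (hself : ∀ i, inner ℝ (T (b i)) (T (b i)) = w i)
    (hne : ∀ i j, i ≠ j → inner ℝ (T (b i)) (T (b j)) = 0) (f : E) :
    HasSum (fun i => w i * inner ℝ (b i) f ^ 2) (‖T f‖ ^ 2) := by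
  have hcoef (i : ι) : inner ℝ (T f) (T (b i)) = inner ℝ (b i) f * w i := by
    have h := ((b.hasSum_repr f).mapL T).mapL (innerSL ℝ (T (b i)))
    have h' : HasSum (fun k => innerSL ℝ (T (b i)) (T (b.repr f k • b k)))
        (inner ℝ (b i) f * w i) := by
      have hi : innerSL ℝ (T (b i)) (T (b.repr f i • b i)) = inner ℝ (b i) f * w i := by
        rw [map_smul, map_smul, innerSL_apply_apply, hself, b.repr_apply_apply, smul_eq_mul]
      rw [← hi]
      refine hasSum_single i fun k hk => ?_
      rw [map_smul, map_smul, innerSL_apply_apply, hne i k hk.symm, smul_zero]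
    rw [real_inner_comm]
    exact h.unique h'
  have h := ((b.hasSum_repr f).mapL T).mapL (innerSL ℝ (T f))
  rw [innerSL_apply_apply, real_inner_self_eq_norm_sq] at h
  convert! h using 1
  ext i
  rw [map_smul, map_smul, innerSL_apply_apply, hcoef, b.repr_apply_apply, smul_eq_mul]
  ring

section TensorBasis

variable {d : ℕ} {H : Type*} [NormedAddCommGroup H] [InnerProductSpace ℝ H]
variable {G : Type*} [NormedAddCommGroup G] [InnerProductSpace ℝ G]
variable {ι : Type*}

theorem norm_pureTensor (x : Fin d → H) : ‖pureTensor x‖ = ∏ l, ‖x l‖ := by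
  refine (pow_left_inj₀ (norm_nonneg _) (Finset.prod_nonneg fun _ _ => norm_nonneg _)
    two_ne_zero).1 ?_
  rw [← real_inner_self_eq_norm_sq, inner_pureTensor, ← Finset.prod_pow]
  simp

theorem pureTensor_update_add (x : Fin d → H) (l : Fin d) (u v : H) :
    pureTensor (Function.update x l (u + v)) =
      pureTensor (Function.update x l u) + pureTensor (Function.update x l v) := by
  rw [pureTensor, pureTensor, pureTensor, ← UniformSpace.Completion.coe_add]
  exact congrArg _ ((PiTensorProduct.tprod ℝ).map_update_add x l u v)

theorem pureTensor_update_smul (x : Fin d → H) (l : Fin d) (a : ℝ) (u : H) :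
    pureTensor (Function.update x l (a • u)) = a • pureTensor (Function.update x l u) := by
  rw [pureTensor, pureTensor, ← UniformSpace.Completion.coe_smul]
  exact congrArg _ ((PiTensorProduct.tprod ℝ).map_update_smul x l a u)

/-- The linear functional `u ↦ ⟨y, x 0 ⊗ ⋯ ⊗ u ⊗ ⋯ ⊗ x (d - 1)⟩`. -/
def slotFunctional (y : HilbertPower d H) (x : Fin d → H) (l : Fin d) : H →L[ℝ] ℝ :=
  LinearMap.mkContinuous
    { toFun := fun u => inner ℝ y (pureTensor (Function.update x l u))
      map_add' := fun u v => by rw [pureTensor_update_add, inner_add_right]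
      map_smul' := fun a u => by
        rw [pureTensor_update_smul, inner_smul_right, RingHom.id_apply, smul_eq_mul] }
    (‖y‖ * ∏ k ∈ Finset.univ.erase l, ‖x k‖) (fun u => by
      refine (norm_inner_le_norm (𝕜 := ℝ) y (pureTensor (Function.update x l u))).trans ?_
      rw [norm_pureTensor, ← Finset.mul_prod_erase _ _ (Finset.mem_univ l), Function.update_self,
        Finset.prod_congr rfl fun k hk => by rw [Function.update_of_ne (Finset.ne_of_mem_erase hk)]]
      exact le_of_eq (by ring))

theorem slotFunctional_apply (y : HilbertPower d H) (x : Fin d → H) (l : Fin d) (u : H) :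
    slotFunctional y x l u = inner ℝ y (pureTensor (Function.update x l u)) := rfl

theorem ext_of_pureTensor {E : Type*} [NormedAddCommGroup E] [NormedSpace ℝ E]
    {A B : HilbertPower d H →L[ℝ] E} (h : ∀ x, A (pureTensor x) = B (pureTensor x)) : A = B := by
  ext y
  induction y using UniformSpace.Completion.induction_on with
  | hp => exact isClosed_eq A.continuous B.continuous
  | ih t =>
    induction t using AlgPower.induction with
    | h0 => rw [UniformSpace.Completion.coe_zero, map_zero, map_zero]
    | ht a x =>
      rw [UniformSpace.Completion.coe_smul, map_smul, map_smul]
      exact congrArg _ (h x)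
    | hadd s t hs ht =>
      rw [UniformSpace.Completion.coe_add, map_add, map_add, hs, ht]

/-- The slots are freed one at a time: as a function of one slot the inner product is continuous and
linear, and it vanishes on the basis, whose span is dense. This gives completeness of the tensor
basis. -/
theorem inner_pureTensor_eq_zero_of_basis (b : HilbertBasis ι ℝ H) (y : HilbertPower d H)
    (hy : ∀ j : Fin d → ι, inner ℝ y (pureTensor fun l => b (j l)) = 0)
    (s : Finset (Fin d)) (x : Fin d → H) (hx : ∀ l ∉ s, ∃ i, x l = b i) :
    inner ℝ y (pureTensor x) = 0 := by
  induction s using Finset.induction_on generalizing x with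
  | empty =>
    choose j hj using fun l => hx l (Finset.notMem_empty l)
    rw [show x = fun l => b (j l) from funext hj]
    exact hy j
  | insert l s hl ih =>
    have h0 : slotFunctional y x l = 0 := by
      refine ContinuousLinearMap.ext_on (s := Set.range b) ?_ ?_
      · exact (Submodule.dense_iff_topologicalClosure_eq_top).2 b.dense_span
      · rintro _ ⟨i, rfl⟩
        rw [slotFunctional_apply, zero_apply]
        refine ih _ fun k hk => ?_
        by_cases hkl : k = l
        · subst hkl
          exact ⟨i, Function.update_self ..⟩
        · rw [Function.update_of_ne hkl]
          exact hx k (by simp [hkl, hk])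
    have := slotFunctional_apply y x l (x l)
    rwa [h0, Function.update_eq_self, zero_apply, eq_comm] at this

theorem orthonormal_pureTensor (b : HilbertBasis ι ℝ H) :
    Orthonormal ℝ fun j : Fin d → ι => pureTensor fun l => b (j l) := by
  constructor
  · intro j
    rw [norm_pureTensor]
    exact Finset.prod_eq_one fun l _ => b.orthonormal.1 _
  · intro j k hjk
    obtain ⟨l, hl⟩ := Function.ne_iff.1 hjk
    simp only [inner_pureTensor]
    exact Finset.prod_eq_zero (Finset.mem_univ l) (b.orthonormal.2 hl)

/-- The tensor products of the elements of a Hilbert basis. -/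
def tensorBasis (b : HilbertBasis ι ℝ H) (d : ℕ) :
    HilbertBasis (Fin d → ι) ℝ (HilbertPower d H) :=
  HilbertBasis.mkOfOrthogonalEqBot (orthonormal_pureTensor b) (by
    rw [eq_bot_iff]
    intro y hy
    have hy' (j : Fin d → ι) : inner ℝ y (pureTensor fun l => b (j l)) = 0 :=
      (Submodule.mem_orthogonal' _ _).1 hy _ (Submodule.subset_span ⟨j, rfl⟩)
    have h0 : innerSL ℝ y = 0 := ext_of_pureTensor fun x => by
      rw [innerSL_apply_apply, zero_apply]
      exact inner_pureTensor_eq_zero_of_basis b y hy' Finset.univ x (by simp)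
    have : inner ℝ y y = 0 := by
      rw [← innerSL_apply_apply (𝕜 := ℝ), h0, zero_apply]
    exact inner_self_eq_zero.1 this)

theorem tensorBasis_apply (b : HilbertBasis ι ℝ H) (j : Fin d → ι) :
    tensorBasis b d j = pureTensor fun l => b (j l) := by
  rw [tensorBasis, HilbertBasis.coe_mkOfOrthogonalEqBot]

theorem hasSum_norm_tensorOp_sq (b : HilbertBasis ι ℝ H) (S : H →L[ℝ] G) (mu : ι → ℝ)
    (hself : ∀ i, inner ℝ (S (b i)) (S (b i)) = mu i)
    (hne : ∀ i j, i ≠ j → inner ℝ (S (b i)) (S (b j)) = 0) (f : HilbertPower d H) :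
    HasSum (fun j : Fin d → ι => (∏ l, mu (j l)) * inner ℝ (tensorBasis b d j) f ^ 2)
      (‖tensorOp d S f‖ ^ 2) := by
  refine hasSum_mul_inner_sq _ _ _ (fun j => ?_) (fun j k hjk => ?_) f
  · simp only [tensorBasis_apply, tensorOp_pureTensor, inner_pureTensor, hself]
  · obtain ⟨l, hl⟩ := Function.ne_iff.1 hjk
    simp only [tensorBasis_apply, tensorOp_pureTensor, inner_pureTensor]
    exact Finset.prod_eq_zero (Finset.mem_univ l) (hne _ _ hl)

theorem hasSum_inner_tensorBasis_sq (b : HilbertBasis ι ℝ H) (f : HilbertPower d H) :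
    HasSum (fun j : Fin d → ι => inner ℝ (tensorBasis b d j) f ^ 2) (‖f‖ ^ 2) := by
  have := (tensorBasis b d).hasSum_inner_mul_inner f f
  rw [real_inner_self_eq_norm_sq] at this
  convert! this using 1
  ext j
  rw [real_inner_comm f, sq]

theorem norm_permOp (π : Equiv.Perm (Fin d)) (f : HilbertPower d H) : ‖permOp π f‖ = ‖f‖ := by
  induction f using UniformSpace.Completion.induction_on with
  | hp => exact isClosed_eq (permOp π).continuous.norm continuous_norm
  | ih t =>
    rw [permOp, ContinuousLinearMap.completion_apply_coe, UniformSpace.Completion.norm_coe,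
      UniformSpace.Completion.norm_coe]
    exact AlgPower.norm_perm π t

theorem inner_permOp_permOp (π : Equiv.Perm (Fin d)) (f g : HilbertPower d H) :
    inner ℝ (permOp π f) (permOp π g) = inner ℝ f g :=
  LinearIsometry.inner_map_map
    (⟨(permOp π : HilbertPower d H →L[ℝ] HilbertPower d H).toLinearMap, norm_permOp π⟩ :
      HilbertPower d H →ₗᵢ[ℝ] HilbertPower d H) f g

/-- The order is reversed because permutations act by precomposition on the index. -/
theorem permOp_comp_permOp (π ρ : Equiv.Perm (Fin d)) :
    (permOp π : HilbertPower d H →L[ℝ] HilbertPower d H) ∘L permOp ρ = permOp (ρ * π) :=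
  ext_of_pureTensor fun x => by
    simp [permOp_pureTensor]

theorem mem_permsOn {I : Finset (Fin d)} {π : Equiv.Perm (Fin d)} :
    π ∈ permsOn I ↔ ∀ l, l ∉ I → π l = l := by
  simp [permsOn]

theorem one_mem_permsOn (I : Finset (Fin d)) : 1 ∈ permsOn I := by simp [mem_permsOn]

theorem card_permsOn_pos (I : Finset (Fin d)) : 0 < ((permsOn I).card : ℝ) := by
  exact_mod_cast Finset.card_pos.2 ⟨1, one_mem_permsOn I⟩

theorem permOp_symmetrizer {I : Finset (Fin d)} {π : Equiv.Perm (Fin d)} (hπ : π ∈ permsOn I)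
    (f : HilbertPower d H) : permOp π (symmetrizer H I f) = symmetrizer H I f := by
  rw [mem_permsOn] at hπ
  simp only [symmetrizer, smul_apply, sum_apply, map_smul,
    map_sum]
  congr 1
  refine Finset.sum_equiv (Equiv.mulRight π) (fun ρ => ?_) (fun ρ _ => ?_)
  · simp only [mem_permsOn, Equiv.coe_mulRight, Equiv.Perm.mul_apply]
    refine ⟨fun h l hl => by rw [hπ l hl, h l hl], fun h l hl => ?_⟩
    have := h l hl
    rwa [hπ l hl] at this
  · rw [Equiv.coe_mulRight, ← permOp_comp_permOp]; rfl

theorem inner_pureTensor_comp_perm {I : Finset (Fin d)} {π : Equiv.Perm (Fin d)}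
    (hπ : π ∈ permsOn I) (x : Fin d → H) (f : symSubspace H I) :
    inner ℝ (pureTensor fun l => x (π l)) (f : HilbertPower d H) =
      inner ℝ (pureTensor x) (f : HilbertPower d H) := by
  obtain ⟨_, g, rfl⟩ := f
  rw [← permOp_pureTensor]
  simp only
  have h := inner_permOp_permOp π (pureTensor x) (symmetrizer H I g)
  rwa [permOp_symmetrizer hπ] at h

/-- The symmetrization of a basis tensor. -/
def symTensor (b : HilbertBasis ι ℝ H) (I : Finset (Fin d)) (j : Fin d → ι) : symSubspace H I :=
  ⟨symmetrizer H I (tensorBasis b d j), ⟨_, rfl⟩⟩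

theorem coe_symTensor (b : HilbertBasis ι ℝ H) (I : Finset (Fin d)) (j : Fin d → ι) :
    (symTensor b I j : HilbertPower d H) =
      ((permsOn I).card : ℝ)⁻¹ • ∑ π ∈ permsOn I, tensorBasis b d (j ∘ π) := by
  simp only [symTensor, symmetrizer, smul_apply, sum_apply,
    tensorBasis_apply, permOp_pureTensor, Function.comp_apply]

theorem inner_tensorBasis_comp_perm (b : HilbertBasis ι ℝ H) {I : Finset (Fin d)}
    {π : Equiv.Perm (Fin d)} (hπ : π ∈ permsOn I) (j : Fin d → ι) (f : symSubspace H I) :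
    inner ℝ (tensorBasis b d (j ∘ π)) (f : HilbertPower d H) =
      inner ℝ (tensorBasis b d j) (f : HilbertPower d H) := by
  rw [tensorBasis_apply, tensorBasis_apply]
  exact inner_pureTensor_comp_perm hπ (fun l => b (j l)) f

/-- A symmetric `f` has equal coefficients along the orbit of `j`, so averaging the basis tensor
over the orbit does not change its inner product with `f`. -/
theorem inner_symTensor (b : HilbertBasis ι ℝ H) (I : Finset (Fin d)) (j : Fin d → ι)
    (f : symSubspace H I) :
    inner ℝ (symTensor b I j) f = inner ℝ (tensorBasis b d j) (f : HilbertPower d H) := by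
  rw [Submodule.coe_inner, coe_symTensor, inner_smul_left, sum_inner,
    Finset.sum_congr rfl fun π hπ => inner_tensorBasis_comp_perm b hπ j f, Finset.sum_const,
    nsmul_eq_mul, conj_trivial, inv_mul_cancel_left₀ (card_permsOn_pos I).ne']

theorem inner_tensorBasis_symTensor [DecidableEq ι] (b : HilbertBasis ι ℝ H) (I : Finset (Fin d))
    (j k : Fin d → ι) :
    inner ℝ (tensorBasis b d k) (symTensor b I j : HilbertPower d H) =
      ((permsOn I).card : ℝ)⁻¹ * ((permsOn I).filter fun π : Equiv.Perm (Fin d) => k = j ∘ π).card := by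
  rw [coe_symTensor, inner_smul_right, inner_sum, Finset.card_filter]
  push_cast
  congr 1
  exact Finset.sum_congr rfl fun π _ =>
    orthonormal_iff_ite.1 (tensorBasis b d).orthonormal k (j ∘ π)

end TensorBasis

/-! ### Information complexity as a count of orbits. -/

section SymProblem

variable {d : ℕ} {H : Type*} [NormedAddCommGroup H] [InnerProductSpace ℝ H]
variable {G : Type*} [NormedAddCommGroup G] [InnerProductSpace ℝ G]
variable {ι : Type*} (b : HilbertBasis ι ℝ H) (S : H →L[ℝ] G) (mu : ι → ℝ)

/-- One functional per code suffices. If all of them vanish at `f`, symmetry kills every coefficient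
of weight above `ε²`, and what remains is damped by `ε`. -/
theorem infoComplexity_symProblem_le
    (hself : ∀ i, inner ℝ (S (b i)) (S (b i)) = mu i)
    (hne : ∀ i j, i ≠ j → inner ℝ (S (b i)) (S (b j)) = 0)
    (I : Finset (Fin d)) {ε : ℝ} (hε : 0 < ε) {κ : Type*} (enc : (Fin d → ι) → κ)
    (henc : ∀ j k, ε ^ 2 < ∏ l, mu (j l) → ε ^ 2 < ∏ l, mu (k l) → enc j = enc k →
      ∃ π ∈ permsOn I, j ∘ π = k)
    (A : Finset κ) (hA : ∀ j, ε ^ 2 < ∏ l, mu (j l) → enc j ∈ A) :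
    infoComplexity (symProblem S I) ε ≤ A.card := by
  classical
  refine infoComplexity_le ?_
  -- Elements of `A` that are not the code of any tuple of large weight get the zero functional.
  let v : ℕ → symSubspace H I := fun i =>
    if h : ∃ j, ε ^ 2 < ∏ l, mu (j l) ∧ ∃ hi : i < A.card, enc j = A.equivFin.symm ⟨i, hi⟩
    then symTensor b I h.choose else 0
  refine minimalError_le_of_orthogonal _ hε.le _ v fun f hf => ?_
  have hzero (j : Fin d → ι) (hj : ε ^ 2 < ∏ l, mu (j l)) :
      inner ℝ (tensorBasis b d j) (f : HilbertPower d H) = 0 := by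
    set i := A.equivFin ⟨enc j, hA j hj⟩ with hi
    have h : ∃ k, ε ^ 2 < ∏ l, mu (k l) ∧
        ∃ hi : (i : ℕ) < A.card, enc k = A.equivFin.symm ⟨i, hi⟩ :=
      ⟨j, hj, i.2, by simp [hi]⟩
    have h1 := hf i i.2
    simp only [v, dif_pos h, inner_symTensor] at h1
    obtain ⟨h0, hlt, h2⟩ := h.choose_spec
    obtain ⟨π, hπ, h3⟩ := henc h.choose j h0 hj (by rw [h2]; simp [hi])
    have h4 := inner_tensorBasis_comp_perm b hπ h.choose f
    rwa [h1, h3] at h4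
  have h1 := hasSum_norm_tensorOp_sq b S mu hself hne (f : HilbertPower d H)
  have h2 := (hasSum_inner_tensorBasis_sq b (f : HilbertPower d H)).mul_left (ε ^ 2)
  have h3 := hasSum_le (fun j => ?_) h1 h2
  · rw [← mul_pow] at h3
    exact (sq_le_sq₀ (norm_nonneg _) (by positivity)).1 h3
  · rcases le_or_gt (∏ l, mu (j l)) (ε ^ 2) with hj | hj
    · exact mul_le_mul_of_nonneg_right hj (sq_nonneg _)
    · rw [hzero j hj]; simp

/-- Symmetrized tensors from distinct orbits are independent. On their span only coefficients from
the orbits of `J` occur, so `S_d` expands there by at least the root of the least weight in `J`. -/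
theorem card_le_infoComplexity_symProblem
    (hself : ∀ i, inner ℝ (S (b i)) (S (b i)) = mu i)
    (hne : ∀ i j, i ≠ j → inner ℝ (S (b i)) (S (b j)) = 0)
    (I : Finset (Fin d)) {ε : ℝ} (hε : 0 ≤ ε) (J : Finset (Fin d → ι))
    (hJ : ∀ j ∈ J, ∀ k ∈ J, ∀ π ∈ permsOn I, j ∘ π = k → j = k)
    (hw : ∀ j ∈ J, ε ^ 2 < ∏ l, mu (j l)) :
    (J.card : ℕ∞) ≤ infoComplexity (symProblem S I) ε := by
  classical
  rcases J.eq_empty_or_nonempty with rfl | hne'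
  · simp
  obtain ⟨j₀, hj₀, hmin⟩ := J.exists_min_image (fun j => ∏ l, mu (j l)) hne'
  have hpos : 0 ≤ ∏ l, mu (j₀ l) := (sq_nonneg ε).trans (hw j₀ hj₀).le
  -- The minimum over the finite set `J` turns the strict inequalities into one constant strictly
  -- above `ε`.
  refine le_infoComplexity (c := √(∏ l, mu (j₀ l))) hε (Real.lt_sqrt_of_sq_lt (hw j₀ hj₀))
    fun n hn => ?_
  let Φ : (J → ℝ) →ₗ[ℝ] symSubspace H I :=
    Fintype.linearCombination ℝ (fun j : J => symTensor b I (j : Fin d → ι))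
  have hΦ (x : J → ℝ) (k : Fin d → ι) :
      inner ℝ (tensorBasis b d k) (Φ x : HilbertPower d H) =
        ∑ j : J, x j * inner ℝ (tensorBasis b d k) (symTensor b I j : HilbertPower d H) := by
    simp only [Φ, Fintype.linearCombination_apply, Submodule.coe_sum, Submodule.coe_smul, inner_sum,
      inner_smul_right]
  have hsym (j k : Fin d → ι)
      (h : inner ℝ (tensorBasis b d k) (symTensor b I j : HilbertPower d H) ≠ 0) :
      ∃ π ∈ permsOn I, j ∘ π = k := by
    rw [inner_tensorBasis_symTensor] at h
    have h1 : ((permsOn I).filter fun π : Equiv.Perm (Fin d) => k = j ∘ π).card ≠ 0 := by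
      rintro h0; simp [h0] at h
    obtain ⟨π, hπ⟩ := Finset.card_ne_zero.1 h1
    rw [Finset.mem_filter] at hπ
    exact ⟨π, hπ.1, hπ.2.symm⟩
  refine le_minimalError_of_linearMap _ n Φ ?_ ?_ (by simpa using hn)
  · rw [← LinearMap.ker_eq_bot, LinearMap.ker_eq_bot']
    intro x hx
    ext k
    have h1 := hΦ x k
    rw [hx, Submodule.coe_zero, inner_zero_right, Finset.sum_eq_single k] at h1
    · have h2 : inner ℝ (tensorBasis b d k) (symTensor b I k : HilbertPower d H) ≠ 0 := by
        rw [inner_tensorBasis_symTensor]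
        refine mul_ne_zero (inv_ne_zero (card_permsOn_pos I).ne') ?_
        exact_mod_cast Finset.card_ne_zero.2 ⟨1, by simp [one_mem_permsOn]⟩
      exact (mul_eq_zero.1 h1.symm).resolve_right h2
    · intro j _ hjk
      by_contra hne0
      obtain ⟨π, hπ, h⟩ := hsym j k (right_ne_zero_of_mul hne0)
      exact hjk (Subtype.ext (hJ j j.2 k k.2 π hπ h))
    · simp
  · intro x
    refine (sq_le_sq₀ (by positivity) (norm_nonneg _)).1 ?_
    rw [mul_pow, Real.sq_sqrt hpos]
    have h1 := hasSum_norm_tensorOp_sq b S mu hself hne (Φ x : HilbertPower d H)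
    have h2 := (hasSum_inner_tensorBasis_sq b (Φ x : HilbertPower d H)).mul_left
      (∏ l, mu (j₀ l))
    refine hasSum_le (fun k => ?_) h2 h1
    by_cases hk : inner ℝ (tensorBasis b d k) (Φ x : HilbertPower d H) = 0
    · rw [hk]; simp
    · refine mul_le_mul_of_nonneg_right ?_ (sq_nonneg _)
      rw [hΦ] at hk
      obtain ⟨j, -, hj⟩ := Finset.exists_ne_zero_of_sum_ne_zero hk
      obtain ⟨π, hπ, rfl⟩ := hsym j k (right_ne_zero_of_mul hj)
      refine (hmin j j.2).trans (le_of_eq ?_)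
      exact (Equiv.prod_comp π fun l => mu ((j : Fin d → ι) l)).symm

end SymProblem

/-! ### Counting orbits of tuples from above -/

section OrbitCount

variable {d : ℕ} {ι : Type*}

/-- The positions in `I` are matched value by value, and the matching is extended by the identity
off `I`. -/
theorem exists_perm_of_card_fiber_eq [DecidableEq ι] (I : Finset (Fin d)) (j k : Fin d → ι)
    (hout : ∀ l, l ∉ I → j l = k l)
    (hin : ∀ i, (I.filter fun l => j l = i).card = (I.filter fun l => k l = i).card) :
    ∃ π ∈ permsOn I, j ∘ π = k := by
  obtain ⟨φ, hφ⟩ := exists_equiv_of_fiber_equiv (fun l : {l // l ∈ I} => k l)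
    (fun l : {l // l ∈ I} => j l) (fun i => by
      have h (u : Fin d → ι) : Fintype.card {a : {l // l ∈ I} // u a = i} =
          (I.filter fun l => u l = i).card := by
        rw [← Fintype.card_coe]
        exact Fintype.card_congr ((Equiv.subtypeSubtypeEquivSubtypeInter (· ∈ I) (u · = i)).trans
          (Equiv.subtypeEquivRight fun l => by simp))
      exact ⟨Fintype.equivOfCardEq (by rw [h, h, hin i])⟩)
  refine ⟨Equiv.Perm.ofSubtype φ, mem_permsOn.2 fun l hl =>
    Equiv.Perm.ofSubtype_apply_of_not_mem φ hl, funext fun l => ?_⟩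
  by_cases hl : l ∈ I
  · rw [Function.comp_apply, Equiv.Perm.ofSubtype_apply_of_mem φ hl]
    exact hφ ⟨l, hl⟩
  · rw [Function.comp_apply, Equiv.Perm.ofSubtype_apply_of_not_mem φ hl, hout l hl]

/-- The multiplicities add up to `#I`, so the one of `i₀` is determined by the rest. This saves a
factor `d + 1`, which is decisive for strong tractability when the eigenvalue `1` is simple. -/
theorem card_fiber_eq_of_ne [DecidableEq ι] (I : Finset (Fin d)) (j k : Fin d → ι) (i₀ : ι)
    (h : ∀ i, i ≠ i₀ → (I.filter fun l => j l = i).card = (I.filter fun l => k l = i).card) (i : ι) :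
    (I.filter fun l => j l = i).card = (I.filter fun l => k l = i).card := by
  by_cases hi : i = i₀
  · subst hi
    -- Inserting `i` lets its term be split off even if neither tuple takes this value on `I`.
    let T : Finset ι := insert i (I.image j ∪ I.image k)
    have hj := Finset.card_eq_sum_card_fiberwise (f := j) (s := I) (t := T) (fun l hl => by
      have := Finset.mem_image_of_mem j hl
      simp only [T, Finset.coe_insert, Finset.coe_union, Set.mem_insert_iff, Set.mem_union]
      exact Or.inr (Or.inl this))
    have hk := Finset.card_eq_sum_card_fiberwise (f := k) (s := I) (t := T) (fun l hl => by
      have := Finset.mem_image_of_mem k hl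
      simp only [T, Finset.coe_insert, Finset.coe_union, Set.mem_insert_iff, Set.mem_union]
      exact Or.inr (Or.inr this))
    have hiT : i ∈ T := Finset.mem_insert_self _ _
    rw [← Finset.add_sum_erase _ _ hiT] at hj hk
    have : ∑ x ∈ T.erase i, (I.filter fun l => j l = x).card =
        ∑ x ∈ T.erase i, (I.filter fun l => k l = x).card :=
      Finset.sum_congr rfl fun x hx => h x (Finset.ne_of_mem_erase hx)
    omega
  · exact h i hi

/-- A code for the orbit of a tuple: the number of occurrences of each `i ∈ s` in the coordinates
from `I`, and the entries in the other coordinates. -/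
def orbitCode [DecidableEq ι] (I : Finset (Fin d)) (s : Finset ι) (j : Fin d → ι) :
    ({i // i ∈ s} → ℕ) × ({l // l ∉ I} → ι) :=
  (fun i => (I.filter fun l => j l = i).card, fun l => j l)

/-- The product of the weights of the entries of a tuple, in terms of its code. -/
def codeWeight (I : Finset (Fin d)) (s : Finset ι) (ν : ι → ℝ)
    (a : ({i // i ∈ s} → ℕ) × ({l // l ∉ I} → ι)) : ℝ :=
  (∏ i : {i // i ∈ s}, ν i ^ a.1 i) * ∏ l, ν (a.2 l)

/-- Grouping the factors on `I` by value gives powers `ν i ^ multiplicity`. The power belonging to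
`i₀` is at most `1` and is dropped. -/
theorem prod_le_codeWeight [DecidableEq ι] (I : Finset (Fin d)) (s : Finset ι) (i₀ : ι) (ν : ι → ℝ)
    (hν0 : ∀ i, 0 ≤ ν i) (hν1 : ∀ i, ν i ≤ 1) (j : Fin d → ι) (hj : ∀ l, j l ∈ s) :
    ∏ l, ν (j l) ≤ codeWeight I (s.erase i₀) ν (orbitCode I (s.erase i₀) j) := by
  have h1 : ∏ l ∈ I, ν (j l) = ∏ i ∈ s, ν i ^ (I.filter fun l => j l = i).card := by
    rw [← Finset.prod_fiberwise_of_maps_to (t := s) (g := j) fun l _ => hj l]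
    refine Finset.prod_congr rfl fun i _ => ?_
    rw [Finset.prod_congr rfl fun l hl => by rw [(Finset.mem_filter.1 hl).2], Finset.prod_const]
  have h2 : ∏ i ∈ s, ν i ^ (I.filter fun l => j l = i).card ≤
      ∏ i ∈ s.erase i₀, ν i ^ (I.filter fun l => j l = i).card := by
    by_cases hi : i₀ ∈ s
    · rw [← Finset.mul_prod_erase _ _ hi]
      exact mul_le_of_le_one_left (Finset.prod_nonneg fun i _ => pow_nonneg (hν0 i) _)
        (pow_le_one₀ (hν0 _) (hν1 _))
    · rw [Finset.erase_eq_of_notMem hi]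
  have h3 : ∏ l : {l // l ∉ I}, ν (j l) = ∏ l ∈ Iᶜ, ν (j l) :=
    (Finset.prod_subtype _ (by simp) fun l => ν (j l)).symm
  have h4 : ∏ i : {i // i ∈ s.erase i₀}, ν i ^ (I.filter fun l => j l = i).card =
      ∏ i ∈ s.erase i₀, ν i ^ (I.filter fun l => j l = i).card :=
    Finset.prod_coe_sort (s.erase i₀) fun i => ν i ^ (I.filter fun l => j l = i).card
  simp only [codeWeight, orbitCode]
  rw [h3, h4, ← Finset.prod_mul_prod_compl I]
  exact mul_le_mul_of_nonneg_right (h1.trans_le h2) (Finset.prod_nonneg fun l _ => hν0 _)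

theorem sum_codeWeight [DecidableEq ι] (I : Finset (Fin d)) (s t : Finset ι) (ν : ι → ℝ) (n : ℕ) :
    ∑ a ∈ (Fintype.piFinset fun _ : {i // i ∈ s} => Finset.range n) ×ˢ
      (Fintype.piFinset fun _ : {l // l ∉ I} => t), codeWeight I s ν a =
    (∏ i ∈ s, ∑ m ∈ Finset.range n, ν i ^ m) * (∑ i ∈ t, ν i) ^ (d - I.card) := by
  simp only [Finset.sum_product, codeWeight, ← Finset.mul_sum, ← Finset.sum_mul]
  rw [← Finset.prod_univ_sum, ← Finset.prod_univ_sum, Finset.prod_const,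
    Finset.prod_coe_sort s fun i => ∑ m ∈ Finset.range n, ν i ^ m]
  congr 2
  rw [Finset.card_univ, Fintype.card_subtype_compl]
  simp

/-- Weierstrass' inequality: `∏ (1 - ν i) ≥ 1 - ∑ ν i ≥ 1 / 2`. -/
theorem prod_inv_one_sub_le (s : Finset ι) (ν : ι → ℝ) (h0 : ∀ i ∈ s, 0 ≤ ν i)
    (h : ∑ i ∈ s, ν i ≤ 1 / 2) : ∏ i ∈ s, (1 - ν i)⁻¹ ≤ 2 := by
  have h1 (i) (hi : i ∈ s) : ν i ≤ 1 / 2 := (Finset.single_le_sum h0 hi).trans h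
  have h2 : 1 - ∑ i ∈ s, ν i ≤ ∏ i ∈ s, (1 - ν i) := by
    clear h
    induction s using Finset.cons_induction with
    | empty => simp
    | cons a s ha ih =>
      rw [Finset.sum_cons, Finset.prod_cons]
      have := ih (fun i hi => h0 i (Finset.mem_cons_of_mem hi))
        (fun i hi => h1 i (Finset.mem_cons_of_mem hi))
      have ha0 := h0 a (Finset.mem_cons_self a s)
      have ha1 := h1 a (Finset.mem_cons_self a s)
      have hs : 0 ≤ ∑ i ∈ s, ν i := Finset.sum_nonneg fun i hi => h0 i (Finset.mem_cons_of_mem hi)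
      nlinarith
  rw [Finset.prod_inv_distrib]
  refine inv_le_of_inv_le₀ (by norm_num) ?_
  linarith

/-- Factors with `ν i < 1` are bounded by full geometric series, with product at most `2`; each
factor with `ν i = 1` equals `n + 1`. -/
theorem prod_geom_sum_le [DecidableEq ι] (s K : Finset ι) (ν : ι → ℝ) (n : ℕ)
    (h0 : ∀ i, 0 ≤ ν i) (h1 : ∀ i, ν i ≤ 1) (hK : ∀ i ∈ s, ν i = 1 → i ∈ K)
    (hsum : ∑ i ∈ s with ν i < 1, ν i ≤ 1 / 2) :
    ∏ i ∈ s, ∑ m ∈ Finset.range (n + 1), ν i ^ m ≤ 2 * ((n : ℝ) + 1) ^ K.card := by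
  have hgeom (i) : 0 ≤ ∑ m ∈ Finset.range (n + 1), ν i ^ m :=
    Finset.sum_nonneg fun m _ => pow_nonneg (h0 i) m
  rw [← Finset.prod_filter_mul_prod_filter_not s fun i => ν i < 1]
  refine mul_le_mul ?_ ?_ (Finset.prod_nonneg fun i _ => hgeom i) (by norm_num)
  · refine (Finset.prod_le_prod (fun i _ => hgeom i) fun i hi => ?_).trans
      (prod_inv_one_sub_le _ ν (fun i _ => h0 i) hsum)
    rw [← tsum_geometric_of_lt_one (h0 i) (Finset.mem_filter.1 hi).2]
    exact (summable_geometric_of_lt_one (h0 i) (Finset.mem_filter.1 hi).2).sum_le_tsum _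
      fun m _ => pow_nonneg (h0 i) m
  · have hone (i) (hi : i ∈ s.filter fun i => ¬ ν i < 1) : ν i = 1 :=
      le_antisymm (h1 i) (not_lt.1 (Finset.mem_filter.1 hi).2)
    calc ∏ i ∈ s with ¬ ν i < 1, ∑ m ∈ Finset.range (n + 1), ν i ^ m
        = ∏ i ∈ s with ¬ ν i < 1, ((n : ℝ) + 1) :=
          Finset.prod_congr rfl fun i hi => by rw [hone i hi]; simp
      _ = ((n : ℝ) + 1) ^ (s.filter fun i => ¬ ν i < 1).card := Finset.prod_const _
      _ ≤ ((n : ℝ) + 1) ^ K.card := by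
          refine pow_le_pow_right₀ (by linarith [Nat.cast_nonneg (α := ℝ) n])
            (Finset.card_le_card fun i hi => hK i (Finset.mem_filter.1 hi).1 (hone i hi))

end OrbitCount

/-! ### Upper bound by power sums of the eigenvalues. -/

section UpperBound

variable {d : ℕ} {H : Type*} [NormedAddCommGroup H] [InnerProductSpace ℝ H]
variable {G : Type*} [NormedAddCommGroup G] [InnerProductSpace ℝ G]
variable {ι : Type*} (b : HilbertBasis ι ℝ H) (S : H →L[ℝ] G) (mu : ι → ℝ)

/-- Chebyshev's inequality: every relevant code has weight at least `ε^(2τ)`, and the total weight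
of all codes factorizes. The three cases of the sufficiency proof differ only in the choice of `σ`
and `K`. -/
theorem infoComplexity_symProblem_le_rpow
    (hself : ∀ i, inner ℝ (S (b i)) (S (b i)) = mu i)
    (hne : ∀ i j, i ≠ j → inner ℝ (S (b i)) (S (b j)) = 0)
    (h0 : ∀ i, 0 ≤ mu i) (h1 : ∀ i, mu i ≤ 1) {τ σ : ℝ} (hτ : 0 < τ)
    (hsum : ∀ s : Finset ι, ∑ i ∈ s, mu i ^ τ ≤ σ)
    (hhalf : ∀ s : Finset ι, (∀ i ∈ s, mu i < 1) → ∑ i ∈ s, mu i ^ τ ≤ 1 / 2)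
    (i₀ : ι) (K : Finset ι) (hK : ∀ i, mu i = 1 → i ≠ i₀ → i ∈ K)
    (I : Finset (Fin d)) {ε : ℝ} (hε : 0 < ε) :
    (infoComplexity (symProblem S I) ε : ℝ≥0∞) ≤
      ENNReal.ofReal (2 * ((d : ℝ) + 1) ^ K.card * σ ^ (d - I.card) * ε ^ (-(2 * τ))) := by
  classical
  set ν : ι → ℝ := fun i => mu i ^ τ with hν
  have hν0 (i) : 0 ≤ ν i := Real.rpow_nonneg (h0 i) τ
  have hν1 (i) : ν i ≤ 1 := Real.rpow_le_one (h0 i) (h1 i) hτ.le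
  have hνlt (i) (h : ν i < 1) : mu i < 1 := by
    refine lt_of_le_of_ne (h1 i) fun h' => ?_
    simp [hν, h'] at h
  have hνone (i) (h : ν i = 1) : mu i = 1 := by
    by_contra h'
    exact (Real.rpow_lt_one (h0 i) (lt_of_le_of_ne (h1 i) h') hτ).ne h
  have hsummable : Summable ν := summable_of_sum_le hν0 hsum
  have hεpos : 0 < (ε ^ 2) ^ τ := by positivity
  have hfin : {i | ε ^ 2 < mu i}.Finite := by
    have := hsummable.tendsto_cofinite_zero.eventually (gt_mem_nhds hεpos)
    rw [Filter.eventually_cofinite] at this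
    refine this.subset fun i hi => ?_
    simp only [Set.mem_ofPred_eq, not_lt] at hi ⊢
    exact Real.rpow_le_rpow (by positivity) hi.le hτ.le
  -- All factors are at most `1`, so a tuple of weight above `ε²` has only entries with `mu i > ε²`.
  set s := hfin.toFinset with hs
  have hmem (j : Fin d → ι) (hj : ε ^ 2 < ∏ l, mu (j l)) (l : Fin d) : j l ∈ s := by
    rw [hs, Set.Finite.mem_toFinset, Set.mem_ofPred_eq]
    refine hj.trans_le ?_
    rw [← Finset.mul_prod_erase _ _ (Finset.mem_univ l)]
    exact mul_le_of_le_one_right (h0 _) (Finset.prod_le_one (fun _ _ => h0 _) fun _ _ => h1 _)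
  let B := (Fintype.piFinset fun _ : {i // i ∈ s.erase i₀} => Finset.range (d + 1)) ×ˢ
      (Fintype.piFinset fun _ : {l // l ∉ I} => s)
  let A := B.filter fun a => (ε ^ 2) ^ τ ≤ codeWeight I (s.erase i₀) ν a
  have hcount := infoComplexity_symProblem_le b S mu hself hne I hε (orbitCode I (s.erase i₀))
    (fun j k hj hk hjk => by
      refine exists_perm_of_card_fiber_eq I j k (fun l hl => ?_) (card_fiber_eq_of_ne I j k i₀ ?_)
      · exact congrFun (congrArg Prod.snd hjk) ⟨l, hl⟩
      · intro i hi
        by_cases his : i ∈ s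
        · exact congrFun (congrArg Prod.fst hjk) ⟨i, Finset.mem_erase.2 ⟨hi, his⟩⟩
        · rw [Finset.filter_false_of_mem fun l _ (h : j l = i) => his (h ▸ hmem j hj l),
            Finset.filter_false_of_mem fun l _ (h : k l = i) => his (h ▸ hmem k hk l)])
    A (fun j hj => by
      refine Finset.mem_filter.2 ⟨Finset.mem_product.2 ⟨?_, ?_⟩, ?_⟩
      · rw [Fintype.mem_piFinset]
        intro i
        rw [Finset.mem_range, Nat.lt_succ_iff]
        exact (Finset.card_le_univ _).trans (by simp)
      · rw [Fintype.mem_piFinset]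
        exact fun l => hmem j hj l
      · refine le_trans ?_ (prod_le_codeWeight I s i₀ ν hν0 hν1 j (hmem j hj))
        rw [Real.finsetProd_rpow _ _ fun l _ => h0 _]
        exact Real.rpow_le_rpow (by positivity) hj.le hτ.le)
  have hA : (A.card : ℝ) * (ε ^ 2) ^ τ ≤ 2 * ((d : ℝ) + 1) ^ K.card * σ ^ (d - I.card) := by
    have hw (a) : 0 ≤ codeWeight I (s.erase i₀) ν a :=
      mul_nonneg (Finset.prod_nonneg fun i _ => pow_nonneg (hν0 _) _)
        (Finset.prod_nonneg fun l _ => hν0 _)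
    calc (A.card : ℝ) * (ε ^ 2) ^ τ ≤ ∑ a ∈ A, codeWeight I (s.erase i₀) ν a := by
          rw [← nsmul_eq_mul]
          exact Finset.card_nsmul_le_sum _ _ _ fun a ha => (Finset.mem_filter.1 ha).2
      _ ≤ ∑ a ∈ B, codeWeight I (s.erase i₀) ν a :=
          Finset.sum_le_sum_of_subset_of_nonneg (Finset.filter_subset _ _) fun a _ _ => hw a
      _ = (∏ i ∈ s.erase i₀, ∑ m ∈ Finset.range (d + 1), ν i ^ m) *
            (∑ i ∈ s, ν i) ^ (d - I.card) := sum_codeWeight _ _ _ _ _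
      _ ≤ 2 * ((d : ℝ) + 1) ^ K.card * σ ^ (d - I.card) := by
          refine mul_le_mul (prod_geom_sum_le _ K ν d hν0 hν1 (fun i hi h => ?_) ?_) ?_ ?_
            (by positivity)
          · exact hK i (hνone i h) (Finset.ne_of_mem_erase hi)
          · exact hhalf _ fun i hi => hνlt i (Finset.mem_filter.1 hi).2
          · exact pow_le_pow_left₀ (Finset.sum_nonneg fun i _ => hν0 i) (hsum s) _
          · exact pow_nonneg (Finset.sum_nonneg fun i _ => hν0 i) _
  calc (infoComplexity (symProblem S I) ε : ℝ≥0∞) ≤ ((A.card : ℕ∞) : ℝ≥0∞) :=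
        ENat.toENNReal_le.2 hcount
    _ = ENNReal.ofReal (A.card : ℝ) := by simp
    _ ≤ _ := by
      refine ENNReal.ofReal_le_ofReal ?_
      have : ε ^ (-(2 * τ)) = ((ε ^ 2) ^ τ)⁻¹ := by
        rw [Real.rpow_neg hε.le, Real.rpow_mul hε.le, Real.rpow_two]
      rw [this, ← div_eq_mul_inv, le_div_iff₀ hεpos]
      exact hA

end UpperBound

/-! ### Sums of powers of eigenvalues from bounds for the information complexity -/

section LowerBound

/-- The positive weights are split into dyadic layers `x / 2 < w ≤ x` with `x = 2^(-m)`. A layer has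
at most `K (x / 2)^(-p / 2)` elements, each contributing at most `x^(p / 2 + 1)`. The surplus `1` in
the exponent leaves a factor `x`, and the layers sum geometrically to the final `2`. -/
theorem sum_rpow_le_of_card_le {α : Type*} (J : Finset α) (w : α → ℝ)
    (h0 : ∀ j ∈ J, 0 ≤ w j) (h1 : ∀ j ∈ J, w j ≤ 1) {K p : ℝ} (hK : 0 ≤ K) (hp : 0 < p)
    (hcount : ∀ ε : ℝ, 0 < ε → ε ≤ 1 →
      ((J.filter fun j => ε ^ 2 < w j).card : ℝ) ≤ K * ε ^ (-p)) :
    ∑ j ∈ J, w j ^ (p / 2 + 1) ≤ K * 2 ^ (p / 2) * 2 := by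
  classical
  have hτ : 0 < p / 2 + 1 := by positivity
  have hlevel (j : α) : ∃ n : ℕ, 0 < w j → w j ≤ 1 →
      (1 / 2 : ℝ) ^ (n + 1) < w j ∧ w j ≤ (1 / 2) ^ n := by
    by_cases h : 0 < w j ∧ w j ≤ 1
    · obtain ⟨n, hn⟩ := exists_nat_pow_near_of_lt_one h.1 h.2 (y := (1 / 2 : ℝ))
        (by norm_num) (by norm_num)
      exact ⟨n, fun _ _ => hn⟩
    · exact ⟨0, fun h2 h3 => absurd ⟨h2, h3⟩ h⟩
  choose n hn using hlevel
  have hfilter : ∑ j ∈ J, w j ^ (p / 2 + 1) = ∑ j ∈ J with 0 < w j, w j ^ (p / 2 + 1) := by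
    rw [Finset.sum_filter]
    refine Finset.sum_congr rfl fun j hj => ?_
    split_ifs with h
    · rfl
    · rw [le_antisymm (not_lt.1 h) (h0 j hj), Real.zero_rpow hτ.ne']
  set J' := J.filter fun j => 0 < w j with hJ'
  rw [hfilter, ← Finset.sum_fiberwise_of_maps_to (t := J'.image n) (g := n)
    fun j hj => Finset.mem_image_of_mem n hj]
  have hfiber (m : ℕ) : ∑ j ∈ J' with n j = m, w j ^ (p / 2 + 1) ≤
      K * 2 ^ (p / 2) * (1 / 2) ^ m := by
    set x : ℝ := (1 / 2) ^ m with hx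
    have hxpos : 0 < x := by positivity
    have hx1 : x ≤ 1 := pow_le_one₀ (by norm_num) (by norm_num)
    have hsq : √(x / 2) ^ 2 = x / 2 := Real.sq_sqrt (by positivity)
    -- This `ε` has `ε²` equal to the lower end of the layer.
    have hc := hcount (√(x / 2)) (Real.sqrt_pos.2 (by positivity))
      (Real.sqrt_le_one.2 (by linarith))
    have hpow : √(x / 2) ^ (-p) = x ^ (-(p / 2)) * 2 ^ (p / 2) := by
      rw [Real.sqrt_eq_rpow, ← Real.rpow_mul (by positivity),
        show 1 / 2 * -p = -(p / 2) by ring, Real.div_rpow hxpos.le (by norm_num),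
        Real.rpow_neg (by norm_num : (0 : ℝ) ≤ 2), div_inv_eq_mul]
    rw [hsq, hpow] at hc
    calc ∑ j ∈ J' with n j = m, w j ^ (p / 2 + 1)
        ≤ (J'.filter fun j => n j = m).card • x ^ (p / 2 + 1) := by
          refine Finset.sum_le_card_nsmul _ _ _ fun j hj => ?_
          rw [Finset.mem_filter, hJ', Finset.mem_filter] at hj
          obtain ⟨⟨hjJ, hpos⟩, rfl⟩ := hj
          exact Real.rpow_le_rpow hpos.le (hn j hpos (h1 j hjJ)).2 hτ.le
      _ ≤ (K * (x ^ (-(p / 2)) * 2 ^ (p / 2))) * x ^ (p / 2 + 1) := by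
          rw [nsmul_eq_mul]
          refine mul_le_mul_of_nonneg_right (le_trans ?_ hc) (by positivity)
          refine Nat.cast_le.2 (Finset.card_le_card fun j hj => ?_)
          rw [Finset.mem_filter, hJ', Finset.mem_filter] at hj
          obtain ⟨⟨hjJ, hpos⟩, rfl⟩ := hj
          refine Finset.mem_filter.2 ⟨hjJ, ?_⟩
          have := (hn j hpos (h1 j hjJ)).1
          rw [pow_succ] at this
          rw [hx]
          linarith
      _ = K * 2 ^ (p / 2) * (x ^ (-(p / 2)) * x ^ (p / 2 + 1)) := by ring
      _ = K * 2 ^ (p / 2) * x := by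
          rw [← Real.rpow_add hxpos, show -(p / 2) + (p / 2 + 1) = 1 by ring, Real.rpow_one]
  calc ∑ m ∈ J'.image n, ∑ j ∈ J' with n j = m, w j ^ (p / 2 + 1)
      ≤ ∑ m ∈ J'.image n, K * 2 ^ (p / 2) * (1 / 2) ^ m := Finset.sum_le_sum fun m _ => hfiber m
    _ = K * 2 ^ (p / 2) * ∑ m ∈ J'.image n, (1 / 2) ^ m := by rw [Finset.mul_sum]
    _ ≤ K * 2 ^ (p / 2) * 2 := by
        refine mul_le_mul_of_nonneg_left ?_ (by positivity)
        exact (summable_geometric_two.sum_le_tsum _ fun m _ => by positivity).trans_eq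
          tsum_geometric_two

variable {d : ℕ} {H : Type*} [NormedAddCommGroup H] [InnerProductSpace ℝ H]
variable {G : Type*} [NormedAddCommGroup G] [InnerProductSpace ℝ G]
variable {ι : Type*} (b : HilbertBasis ι ℝ H) (S : H →L[ℝ] G) (mu : ι → ℝ)

theorem sum_rpow_le_of_infoComplexity_le
    (hself : ∀ i, inner ℝ (S (b i)) (S (b i)) = mu i)
    (hne : ∀ i j, i ≠ j → inner ℝ (S (b i)) (S (b j)) = 0)
    (h0 : ∀ i, 0 ≤ mu i) (h1 : ∀ i, mu i ≤ 1) {K p : ℝ} (hK : 0 ≤ K) (hp : 0 < p)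
    (I : Finset (Fin d))
    (hn : ∀ ε : ℝ, 0 < ε → ε ≤ 1 →
      (infoComplexity (symProblem S I) ε : ℝ≥0∞) ≤ ENNReal.ofReal (K * ε ^ (-p)))
    (J : Finset (Fin d → ι))
    (hJ : ∀ j ∈ J, ∀ k ∈ J, ∀ π ∈ permsOn I, j ∘ π = k → j = k) :
    ∑ j ∈ J, (∏ l, mu (j l)) ^ (p / 2 + 1) ≤ K * 2 ^ (p / 2) * 2 := by
  classical
  refine sum_rpow_le_of_card_le J _ (fun j _ => Finset.prod_nonneg fun _ _ => h0 _)
    (fun j _ => Finset.prod_le_one (fun _ _ => h0 _) fun _ _ => h1 _) hK hp fun ε hε hε1 => ?_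
  have h := card_le_infoComplexity_symProblem b S mu hself hne I hε.le
    (J.filter fun j => ε ^ 2 < ∏ l, mu (j l))
    (fun j hj k hk => hJ j (Finset.mem_filter.1 hj).1 k (Finset.mem_filter.1 hk).1)
    (fun j hj => (Finset.mem_filter.1 hj).2)
  have h' := (ENat.toENNReal_le.2 h).trans (hn ε hε hε1)
  rw [ENat.toENNReal_coe, ← ENNReal.ofReal_natCast,
    ENNReal.ofReal_le_ofReal_iff (by positivity)] at h'
  exact h'

/-- The tuple with the entry `i₁` on `t` and the entry `i₀` elsewhere. -/
def indicatorTuple (i₀ i₁ : ι) (t : Finset (Fin d)) : Fin d → ι :=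
  fun l => if l ∈ t then i₁ else i₀

theorem indicatorTuple_eq_iff {i₀ i₁ : ι} (h : i₀ ≠ i₁) (t : Finset (Fin d)) (l : Fin d) :
    indicatorTuple i₀ i₁ t l = i₁ ↔ l ∈ t := by
  rw [indicatorTuple]
  split_ifs with hl
  · simp [hl]
  · simp [hl, h]

theorem indicatorTuple_injective {i₀ i₁ : ι} (h : i₀ ≠ i₁) :
    Function.Injective (indicatorTuple i₀ i₁ : Finset (Fin d) → Fin d → ι) := by
  intro t t' htt
  ext l
  rw [← indicatorTuple_eq_iff h t l, htt, indicatorTuple_eq_iff h]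

theorem mem_iff_of_indicatorTuple_comp {i₀ i₁ : ι} (h : i₀ ≠ i₁) {t t' : Finset (Fin d)}
    {π : Equiv.Perm (Fin d)} (hπ : indicatorTuple i₀ i₁ t ∘ π = indicatorTuple i₀ i₁ t')
    (l : Fin d) : π l ∈ t ↔ l ∈ t' := by
  rw [← indicatorTuple_eq_iff h t', ← hπ, Function.comp_apply, indicatorTuple_eq_iff h]

theorem prod_indicatorTuple {i₀ i₁ : ι} (h0 : mu i₀ = 1) (t : Finset (Fin d)) :
    ∏ l, mu (indicatorTuple i₀ i₁ t l) = mu i₁ ^ t.card := by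
  classical
  have (l : Fin d) : mu (indicatorTuple i₀ i₁ t l) = if l ∈ t then mu i₁ else 1 := by
    rw [indicatorTuple]; split_ifs <;> simp [h0]
  simp only [this, Finset.prod_ite_mem, Finset.univ_inter, Finset.prod_const]

/-- Tuples with entry `i₁` on `t ⊆ Iᶜ` and `i₀` elsewhere are inequivalent, since the permutations
fix `Iᶜ` pointwise. Summing their weights is the binomial theorem over subsets. -/
theorem one_add_rpow_pow_le
    (hself : ∀ i, inner ℝ (S (b i)) (S (b i)) = mu i)
    (hne : ∀ i j, i ≠ j → inner ℝ (S (b i)) (S (b j)) = 0)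
    (h0 : ∀ i, 0 ≤ mu i) (h1 : ∀ i, mu i ≤ 1) {K p : ℝ} (hK : 0 ≤ K) (hp : 0 < p)
    (I : Finset (Fin d))
    (hn : ∀ ε : ℝ, 0 < ε → ε ≤ 1 →
      (infoComplexity (symProblem S I) ε : ℝ≥0∞) ≤ ENNReal.ofReal (K * ε ^ (-p)))
    {i₀ i₁ : ι} (hi : i₀ ≠ i₁) (hi₀ : mu i₀ = 1) :
    (1 + mu i₁ ^ (p / 2 + 1)) ^ (d - I.card) ≤ K * 2 ^ (p / 2) * 2 := by
  classical
  have h := sum_rpow_le_of_infoComplexity_le b S mu hself hne h0 h1 hK hp I hn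
    (Iᶜ.powerset.image (indicatorTuple i₀ i₁)) (by
      intro j hj k hk π hπ hjk
      obtain ⟨t, ht, rfl⟩ := Finset.mem_image.1 hj
      obtain ⟨t', ht', rfl⟩ := Finset.mem_image.1 hk
      rw [Finset.mem_powerset] at ht ht'
      congr 1
      ext l
      by_cases hl : l ∈ I
      · exact ⟨fun h => absurd hl (Finset.mem_compl.1 (ht h)),
          fun h => absurd hl (Finset.mem_compl.1 (ht' h))⟩
      · rw [← mem_iff_of_indicatorTuple_comp hi hjk l, mem_permsOn.1 hπ l hl])
  rw [Finset.sum_image fun t _ t' _ h => indicatorTuple_injective hi h] at h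
  refine le_trans (le_of_eq ?_) h
  have hs := Finset.sum_pow_mul_eq_add_pow (mu i₁ ^ (p / 2 + 1)) 1 Iᶜ
  rw [Finset.card_compl, Fintype.card_fin] at hs
  rw [add_comm, ← hs]
  refine Finset.sum_congr rfl fun t _ => ?_
  rw [prod_indicatorTuple mu hi₀, one_pow, mul_one, ← Real.rpow_natCast, ← Real.rpow_natCast,
    ← Real.rpow_mul (h0 _), ← Real.rpow_mul (h0 _), mul_comm]

/-- Permutations preserve the number of entries `i₁`, which can be any of `0, …, #I` on `I`. With
both eigenvalues equal to `1`, each of these tuples has weight `1`. -/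
theorem card_add_one_le
    (hself : ∀ i, inner ℝ (S (b i)) (S (b i)) = mu i)
    (hne : ∀ i j, i ≠ j → inner ℝ (S (b i)) (S (b j)) = 0)
    (h0 : ∀ i, 0 ≤ mu i) (h1 : ∀ i, mu i ≤ 1) {K p : ℝ} (hK : 0 ≤ K) (hp : 0 < p)
    (I : Finset (Fin d))
    (hn : ∀ ε : ℝ, 0 < ε → ε ≤ 1 →
      (infoComplexity (symProblem S I) ε : ℝ≥0∞) ≤ ENNReal.ofReal (K * ε ^ (-p)))
    {i₀ i₁ : ι} (hi : i₀ ≠ i₁) (hi₀ : mu i₀ = 1) (hi₁ : mu i₁ = 1) :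
    (I.card : ℝ) + 1 ≤ K * 2 ^ (p / 2) * 2 := by
  classical
  have ht (m : Fin (I.card + 1)) : ∃ t ⊆ I, t.card = m :=
    Finset.exists_subset_card_eq (Nat.lt_succ_iff.1 m.2)
  choose t htI htcard using ht
  have h := sum_rpow_le_of_infoComplexity_le b S mu hself hne h0 h1 hK hp I hn
    (Finset.univ.image fun m => indicatorTuple i₀ i₁ (t m)) (by
      intro j hj k hk π hπ hjk
      obtain ⟨m, -, rfl⟩ := Finset.mem_image.1 hj
      obtain ⟨m', -, rfl⟩ := Finset.mem_image.1 hk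
      have : (t m).card = (t m').card := by
        refine (Finset.card_bij (fun l _ => π l) (fun l hl => ?_) (fun l _ l' _ h => π.injective h)
          (fun l hl => ⟨π.symm l, ?_, π.apply_symm_apply l⟩)).symm
        · exact (mem_iff_of_indicatorTuple_comp hi hjk l).2 hl
        · rw [← mem_iff_of_indicatorTuple_comp hi hjk, π.apply_symm_apply]; exact hl
      rw [htcard, htcard] at this
      rw [Fin.ext this])
  rw [Finset.sum_image fun m _ m' _ h => Fin.ext (by
    rw [← htcard m, ← htcard m', indicatorTuple_injective hi h])] at h
  simpa [prod_indicatorTuple mu hi₀, hi₁] using h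

theorem sum_rpow_le_of_dim_one
    (hself : ∀ i, inner ℝ (S (b i)) (S (b i)) = mu i)
    (hne : ∀ i j, i ≠ j → inner ℝ (S (b i)) (S (b j)) = 0)
    (h0 : ∀ i, 0 ≤ mu i) (h1 : ∀ i, mu i ≤ 1) {K p : ℝ} (hK : 0 ≤ K) (hp : 0 < p)
    (I : Finset (Fin 1))
    (hn : ∀ ε : ℝ, 0 < ε → ε ≤ 1 →
      (infoComplexity (symProblem S I) ε : ℝ≥0∞) ≤ ENNReal.ofReal (K * ε ^ (-p)))
    (s : Finset ι) :
    ∑ i ∈ s, mu i ^ (p / 2 + 1) ≤ K * 2 ^ (p / 2) * 2 := by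
  classical
  have h := sum_rpow_le_of_infoComplexity_le b S mu hself hne h0 h1 hK hp I hn
    (s.image fun i _ => i) (fun j _ k _ π _ hjk => by
      rw [← hjk, Subsingleton.elim π 1]; rfl)
  rw [Finset.sum_image fun i _ i' _ h => congrFun h 0] at h
  simpa using h

end LowerBound

/-! ### Tractability -/

section Tractability

theorem summable_rpow_subtype_pos_iff {α : Type*} {f : α → ℝ} (hf : ∀ a, 0 ≤ f a) {τ : ℝ}
    (hτ : 0 < τ) : (Summable fun a : {a // 0 < f a} => f a ^ τ) ↔ Summable fun a => f a ^ τ :=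
  Subtype.val_injective.summable_iff (f := fun a => f a ^ τ) fun a ha => by
    have : ¬ 0 < f a := fun h => ha ⟨⟨a, h⟩, rfl⟩
    simp only [le_antisymm (not_lt.1 this) (hf a), Real.zero_rpow hτ.ne']

theorem summable_rpow_iff_of_equiv {ι κ : Type*} {mu : ι → ℝ} {lam : κ → ℝ}
    (hmu : ∀ i, 0 ≤ mu i) (hlam : ∀ m, 0 ≤ lam m)
    (φ : {i // 0 < mu i} ≃ {m // 0 < lam m}) (hφ : ∀ i, lam (φ i) = mu i) {τ : ℝ} (hτ : 0 < τ) :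
    (Summable fun i => mu i ^ τ) ↔ Summable fun m => lam m ^ τ := by
  rw [← summable_rpow_subtype_pos_iff hmu hτ, ← summable_rpow_subtype_pos_iff hlam hτ,
    ← φ.summable_iff]
  exact summable_congr fun i => by simp [hφ]

/-- Raising the exponent to `τ + n` sends every term with `mu i < 1` to zero, and dominated
convergence sends their sum to zero. -/
theorem exists_exponent_sum_le_half {ι : Type*} {mu : ι → ℝ} (h0 : ∀ i, 0 ≤ mu i)
    (h1 : ∀ i, mu i ≤ 1) {τ : ℝ} (hτ : 0 < τ) (hsum : Summable fun i => mu i ^ τ) :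
    ∃ τ' : ℝ, 0 < τ' ∧ Summable (fun i => mu i ^ τ') ∧
      ∀ s : Finset ι, (∀ i ∈ s, mu i < 1) → ∑ i ∈ s, mu i ^ τ' ≤ 1 / 2 := by
  classical
  let f : ℕ → ι → ℝ := fun n i => if mu i < 1 then mu i ^ τ * mu i ^ n else 0
  have hf0 (n i) : 0 ≤ f n i := by
    simp only [f]
    split_ifs
    · exact mul_nonneg (Real.rpow_nonneg (h0 i) _) (pow_nonneg (h0 i) _)
    · exact le_rfl
  have hbound (n i) : f n i ≤ mu i ^ τ := by
    simp only [f]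
    split_ifs
    · exact mul_le_of_le_one_right (Real.rpow_nonneg (h0 i) _) (pow_le_one₀ (h0 i) (h1 i))
    · exact Real.rpow_nonneg (h0 i) _
  have hlim : Filter.Tendsto (fun n => ∑' i, f n i) Filter.atTop (nhds (∑' _ : ι, (0 : ℝ))) := by
    refine tendsto_tsum_of_dominated_convergence hsum (fun i => ?_)
      (Filter.Eventually.of_forall fun n i => by
        rw [Real.norm_of_nonneg (hf0 n i)]; exact hbound n i)
    by_cases h : mu i < 1
    · simp only [f, if_pos h]
      simpa using (tendsto_pow_atTop_nhds_zero_of_lt_one (h0 i) h).const_mul (mu i ^ τ)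
    · simp only [f, if_neg h]
      exact tendsto_const_nhds
  rw [tsum_zero] at hlim
  obtain ⟨n, hn⟩ := (hlim.eventually (gt_mem_nhds (by norm_num : (0 : ℝ) < 1 / 2))).exists
  have hadd (i) : mu i ^ (τ + n) = mu i ^ τ * mu i ^ n := by
    rw [Real.rpow_add_of_nonneg (h0 i) hτ.le (Nat.cast_nonneg n), Real.rpow_natCast]
  refine ⟨τ + n, by positivity, ?_, fun s hs => ?_⟩
  · refine Summable.of_nonneg_of_le (fun i => Real.rpow_nonneg (h0 i) _) (fun i => ?_) hsum
    rw [hadd]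
    exact mul_le_of_le_one_right (Real.rpow_nonneg (h0 i) _) (pow_le_one₀ (h0 i) (h1 i))
  · calc ∑ i ∈ s, mu i ^ (τ + n) = ∑ i ∈ s, f n i :=
          Finset.sum_congr rfl fun i hi => by simp only [f, if_pos (hs i hi), hadd]
      _ ≤ ∑' i, f n i := (Summable.of_nonneg_of_le (hf0 n) (hbound n) hsum).sum_le_tsum _
          fun i _ => hf0 n i
      _ ≤ 1 / 2 := hn.le

theorem StronglyPolynomiallyTractable.polynomiallyTractable {n : ℝ → ℕ → ℕ∞}
    (h : StronglyPolynomiallyTractable n) : PolynomiallyTractable n := by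
  obtain ⟨C, p, hC, hp, hb⟩ := h
  exact ⟨C, p, 0, hC, hp, le_rfl, hb⟩

theorem cast_sub_card {d : ℕ} (I : Finset (Fin d)) :
    ((d - I.card : ℕ) : ℝ) = (d : ℝ) - (I.card : ℝ) :=
  Nat.cast_sub (by simpa using Finset.card_le_univ I)

theorem exists_forall_le_of_isBigO_one {I : (d : ℕ) → Finset (Fin d)}
    (h : (fun d : ℕ => (d : ℝ) - ((I d).card : ℝ)) =O[Filter.atTop] fun _ => (1 : ℝ)) :
    ∃ M : ℕ, ∀ d, d - (I d).card ≤ M := by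
  obtain ⟨c, hc⟩ := h.bound
  obtain ⟨N, hN⟩ := Filter.eventually_atTop.1 hc
  refine ⟨max N ⌈c⌉₊, fun d => ?_⟩
  rcases le_total N d with hd | hd
  · have h1 := hN d hd
    rw [← cast_sub_card, norm_one, mul_one, Real.norm_of_nonneg (Nat.cast_nonneg _)] at h1
    exact le_max_of_le_right (Nat.cast_le.1 (h1.trans (Nat.le_ceil c)))
  · exact le_max_of_le_left ((Nat.sub_le _ _).trans hd)

/-- The identity `σ ^ (c log d) = d ^ (c log σ)` turns logarithmic growth of the exponent into a
power of `d`. The factor `σ ^ N` covers the finitely many `d` before the asymptotic bound applies.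
-/
theorem exists_pow_le_of_isBigO_log {I : (d : ℕ) → Finset (Fin d)}
    (h : (fun d : ℕ => (d : ℝ) - ((I d).card : ℝ)) =O[Filter.atTop] fun d : ℕ => Real.log d)
    {σ : ℝ} (hσ : 1 ≤ σ) :
    ∃ A q : ℝ, 0 < A ∧ 0 ≤ q ∧ ∀ d : ℕ, 1 ≤ d → σ ^ (d - (I d).card) ≤ A * (d : ℝ) ^ q := by
  obtain ⟨c, hc0, hc⟩ := h.exists_pos
  obtain ⟨N, hN⟩ := Filter.eventually_atTop.1 hc.bound
  have hσ0 : 0 < σ := by linarith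
  have hlog : 0 ≤ Real.log σ := Real.log_nonneg hσ
  refine ⟨σ ^ N, c * Real.log σ, by positivity, by positivity, fun d hd => ?_⟩
  have hd1 : (1 : ℝ) ≤ d := by exact_mod_cast hd
  have hpow : 1 ≤ (d : ℝ) ^ (c * Real.log σ) := Real.one_le_rpow hd1 (by positivity)
  have hσN : 1 ≤ σ ^ N := one_le_pow₀ hσ
  rcases le_total N d with hNd | hdN
  · have h1 := hN d hNd
    rw [← cast_sub_card, Real.norm_of_nonneg (Nat.cast_nonneg _),
      Real.norm_of_nonneg (Real.log_nonneg hd1)] at h1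
    have h2 : σ ^ (d - (I d).card) ≤ (d : ℝ) ^ (c * Real.log σ) := by
      rw [Real.rpow_def_of_pos (by linarith), ← Real.rpow_natCast, Real.rpow_def_of_pos hσ0]
      refine Real.exp_le_exp.2 ?_
      nlinarith
    exact h2.trans (le_mul_of_one_le_left (by linarith) hσN)
  · refine le_trans (pow_le_pow_right₀ hσ ((Nat.sub_le _ _).trans hdN)) ?_
    exact le_mul_of_one_le_right (by linarith) hpow

variable {H : Type*} [NormedAddCommGroup H] [InnerProductSpace ℝ H]
variable {G : Type*} [NormedAddCommGroup G] [InnerProductSpace ℝ G]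
variable {ι : Type*} (b : HilbertBasis ι ℝ H) (S : H →L[ℝ] G) (mu : ι → ℝ)

/-- Here the whole power sum is at most `1 / 2`, so `σ = 1` and `K = ∅` are admissible and `I` plays
no role. -/
theorem stronglyPolynomiallyTractable_of_lt_one
    (hself : ∀ i, inner ℝ (S (b i)) (S (b i)) = mu i)
    (hne : ∀ i j, i ≠ j → inner ℝ (S (b i)) (S (b j)) = 0)
    (h0 : ∀ i, 0 ≤ mu i) (h1 : ∀ i, mu i < 1) (i₀ : ι) (I : (d : ℕ) → Finset (Fin d))
    {τ : ℝ} (hτ : 0 < τ) (hsum : Summable fun i => mu i ^ τ) :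
    StronglyPolynomiallyTractable fun ε d => infoComplexity (symProblem S (I d)) ε := by
  obtain ⟨τ', hτ', -, hhalf⟩ := exists_exponent_sum_le_half h0 (fun i => (h1 i).le) hτ hsum
  refine ⟨2, 2 * τ', by norm_num, by positivity, fun d _ ε hε _ => ?_⟩
  have h := infoComplexity_symProblem_le_rpow b S mu hself hne h0 (fun i => (h1 i).le) hτ' (σ := 1)
    (fun s => (hhalf s fun i _ => h1 i).trans (by norm_num)) hhalf i₀ ∅
    (fun i hi => absurd hi (h1 i).ne) (I d) hε
  simpa using h

/-- The only possible index with eigenvalue `1` is the omitted `i₀`. Hence `K = ∅`, and no power of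
`d` appears. -/
theorem stronglyPolynomiallyTractable_of_isBigO_one
    (hself : ∀ i, inner ℝ (S (b i)) (S (b i)) = mu i)
    (hne : ∀ i j, i ≠ j → inner ℝ (S (b i)) (S (b j)) = 0)
    (h0 : ∀ i, 0 ≤ mu i) (h1 : ∀ i, mu i ≤ 1) (i₀ : ι) (huniq : ∀ i, mu i = 1 → i = i₀)
    (I : (d : ℕ) → Finset (Fin d))
    (hI : (fun d : ℕ => (d : ℝ) - ((I d).card : ℝ)) =O[Filter.atTop] fun _ => (1 : ℝ))
    {τ : ℝ} (hτ : 0 < τ) (hsum : Summable fun i => mu i ^ τ) :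
    StronglyPolynomiallyTractable fun ε d => infoComplexity (symProblem S (I d)) ε := by
  obtain ⟨τ', hτ', hsum', hhalf⟩ := exists_exponent_sum_le_half h0 h1 hτ hsum
  obtain ⟨M, hM⟩ := exists_forall_le_of_isBigO_one hI
  set σ := max 1 (∑' i, mu i ^ τ')
  have hσ : 1 ≤ σ := le_max_left _ _
  refine ⟨2 * σ ^ M, 2 * τ', by positivity, by positivity, fun d _ ε hε _ => ?_⟩
  have h := infoComplexity_symProblem_le_rpow b S mu hself hne h0 h1 hτ' (σ := σ)
    (fun s => (hsum'.sum_le_tsum s fun i _ => Real.rpow_nonneg (h0 i) _).trans (le_max_right _ _))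
    hhalf i₀ ∅ (fun i hi hi₀ => absurd (huniq i hi) hi₀) (I d) hε
  refine h.trans (ENNReal.ofReal_le_ofReal ?_)
  rw [Finset.card_empty, pow_zero, mul_one, Real.rpow_zero, mul_one]
  have := pow_le_pow_right₀ hσ (hM d)
  gcongr

theorem polynomiallyTractable_of_isBigO_log
    (hself : ∀ i, inner ℝ (S (b i)) (S (b i)) = mu i)
    (hne : ∀ i j, i ≠ j → inner ℝ (S (b i)) (S (b j)) = 0)
    (h0 : ∀ i, 0 ≤ mu i) (h1 : ∀ i, mu i ≤ 1) (i₀ : ι) (I : (d : ℕ) → Finset (Fin d))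
    (hI : (fun d : ℕ => (d : ℝ) - ((I d).card : ℝ)) =O[Filter.atTop] fun d : ℕ => Real.log d)
    {τ : ℝ} (hτ : 0 < τ) (hsum : Summable fun i => mu i ^ τ) :
    PolynomiallyTractable fun ε d => infoComplexity (symProblem S (I d)) ε := by
  obtain ⟨τ', hτ', hsum', hhalf⟩ := exists_exponent_sum_le_half h0 h1 hτ hsum
  set σ := max 1 (∑' i, mu i ^ τ')
  have hσ : 1 ≤ σ := le_max_left _ _
  obtain ⟨A, q, hA, hq, hAq⟩ := exists_pow_le_of_isBigO_log hI hσ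
  have hfin : {i | mu i = 1}.Finite := by
    have := hsum'.tendsto_cofinite_zero.eventually (gt_mem_nhds one_pos)
    rw [Filter.eventually_cofinite] at this
    refine this.subset fun i hi => ?_
    simp only [Set.mem_ofPred_eq, not_lt] at hi ⊢
    rw [hi, Real.one_rpow]
  set K := hfin.toFinset
  refine ⟨2 * 2 ^ K.card * A, 2 * τ', K.card + q, by positivity, by positivity, by positivity,
    fun d hd ε hε _ => ?_⟩
  have h := infoComplexity_symProblem_le_rpow b S mu hself hne h0 h1 hτ' (σ := σ)
    (fun s => (hsum'.sum_le_tsum s fun i _ => Real.rpow_nonneg (h0 i) _).trans (le_max_right _ _))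
    hhalf i₀ K (fun i hi _ => hfin.mem_toFinset.2 hi) (I d) hε
  refine h.trans (ENNReal.ofReal_le_ofReal ?_)
  have hd1 : (1 : ℝ) ≤ d := by exact_mod_cast hd
  have hdpos : (0 : ℝ) < d := by linarith
  have h2 : ((d : ℝ) + 1) ^ K.card ≤ 2 ^ K.card * (d : ℝ) ^ K.card := by
    rw [← mul_pow]
    exact pow_le_pow_left₀ (by positivity) (by linarith) _
  calc 2 * ((d : ℝ) + 1) ^ K.card * σ ^ (d - (I d).card) * ε ^ (-(2 * τ'))
      ≤ 2 * (2 ^ K.card * (d : ℝ) ^ K.card) * (A * (d : ℝ) ^ q) * ε ^ (-(2 * τ')) := by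
        have := hAq d hd
        gcongr
    _ = 2 * 2 ^ K.card * A * ε ^ (-(2 * τ')) * (d : ℝ) ^ ((K.card : ℝ) + q) := by
        rw [Real.rpow_add hdpos, Real.rpow_natCast]; ring

theorem summable_of_tractabilityBound
    (hself : ∀ i, inner ℝ (S (b i)) (S (b i)) = mu i)
    (hne : ∀ i j, i ≠ j → inner ℝ (S (b i)) (S (b j)) = 0)
    (h0 : ∀ i, 0 ≤ mu i) (h1 : ∀ i, mu i ≤ 1) (I : (d : ℕ) → Finset (Fin d)) {C p q : ℝ}
    (hC : 0 < C) (hp : 0 < p)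
    (h : TractabilityBound (fun ε d => infoComplexity (symProblem S (I d)) ε) C p q) :
    Summable fun i => mu i ^ (p / 2 + 1) := by
  refine summable_of_sum_le (fun i => Real.rpow_nonneg (h0 i) _)
    (sum_rpow_le_of_dim_one b S mu hself hne h0 h1 hC.le hp (I 1) fun ε hε hε1 => ?_)
  simpa using h 1 le_rfl ε hε hε1

theorem one_add_rpow_pow_le_of_tractabilityBound
    (hself : ∀ i, inner ℝ (S (b i)) (S (b i)) = mu i)
    (hne : ∀ i j, i ≠ j → inner ℝ (S (b i)) (S (b j)) = 0)
    (h0 : ∀ i, 0 ≤ mu i) (h1 : ∀ i, mu i ≤ 1) (I : (d : ℕ) → Finset (Fin d)) {C p q : ℝ}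
    (hC : 0 < C) (hp : 0 < p)
    (h : TractabilityBound (fun ε d => infoComplexity (symProblem S (I d)) ε) C p q)
    {i₀ i₁ : ι} (hi : i₀ ≠ i₁) (hi₀ : mu i₀ = 1) {d : ℕ} (hd : 1 ≤ d) :
    (1 + mu i₁ ^ (p / 2 + 1)) ^ (d - (I d).card) ≤ C * (d : ℝ) ^ q * 2 ^ (p / 2) * 2 := by
  refine one_add_rpow_pow_le b S mu hself hne h0 h1 (by positivity) hp (I d)
    (fun ε hε hε1 => ?_) hi hi₀
  rw [mul_right_comm]
  exact h d hd ε hε hε1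

theorem isBigO_log_of_pow_le {I : (d : ℕ) → Finset (Fin d)} {x D q : ℝ} (hx : 1 < x) (hD : 0 < D)
    (h : ∀ d : ℕ, 1 ≤ d → x ^ (d - (I d).card) ≤ D * (d : ℝ) ^ q) :
    (fun d : ℕ => (d : ℝ) - ((I d).card : ℝ)) =O[Filter.atTop] fun d : ℕ => Real.log d := by
  have hlogx : 0 < Real.log x := Real.log_pos hx
  -- Once `log d ≥ 1`, the constant `log D` is absorbed into `|log D| * log d`.
  refine Asymptotics.IsBigO.of_bound ((|Real.log D| + q) / Real.log x) ?_
  have hev : ∀ᶠ d : ℕ in Filter.atTop, 1 ≤ Real.log d :=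
    (Real.tendsto_log_atTop.comp tendsto_natCast_atTop_atTop).eventually_ge_atTop 1
  filter_upwards [hev, Filter.eventually_ge_atTop 1] with d hlogd hd
  have hdpos : (0 : ℝ) < d := by exact_mod_cast hd
  rw [← cast_sub_card, Real.norm_of_nonneg (Nat.cast_nonneg _), Real.norm_of_nonneg (by linarith),
    div_mul_eq_mul_div, le_div_iff₀ hlogx, ← Real.log_pow]
  refine (Real.log_le_log (by positivity) (h d hd)).trans ?_
  rw [Real.log_mul hD.ne' (by positivity), Real.log_rpow hdpos, add_mul]
  have := le_abs_self (Real.log D)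
  nlinarith [abs_nonneg (Real.log D)]

theorem sub_card_le_of_pow_le {d : ℕ} {I : Finset (Fin d)} {x D : ℝ} (hx : 1 < x)
    (h : x ^ (d - I.card) ≤ D) : (d : ℝ) - (I.card : ℝ) ≤ Real.log D / Real.log x := by
  rw [← cast_sub_card, le_div_iff₀ (Real.log_pos hx), ← Real.log_pow]
  exact Real.log_le_log (by positivity) h

theorem isBigO_one_of_pow_le {I : (d : ℕ) → Finset (Fin d)} {x D : ℝ} (hx : 1 < x)
    (h : ∀ d : ℕ, 1 ≤ d → x ^ (d - (I d).card) ≤ D) :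
    (fun d : ℕ => (d : ℝ) - ((I d).card : ℝ)) =O[Filter.atTop] fun _ => (1 : ℝ) := by
  refine Asymptotics.IsBigO.of_bound (Real.log D / Real.log x) ?_
  filter_upwards [Filter.eventually_ge_atTop 1] with d hd
  rw [norm_one, mul_one, ← cast_sub_card, Real.norm_of_nonneg (Nat.cast_nonneg _), cast_sub_card]
  exact sub_card_le_of_pow_le hx (h d hd)

/-- If a second eigenvalue were `1`, then `2 ^ (d - #I) ≤ D` would bound the size of `Iᶜ` and `#I +
1 ≤ D` that of `I`, which is impossible for large `d`. -/
theorem lt_one_of_tractabilityBound_zero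
    (hself : ∀ i, inner ℝ (S (b i)) (S (b i)) = mu i)
    (hne : ∀ i j, i ≠ j → inner ℝ (S (b i)) (S (b j)) = 0)
    (h0 : ∀ i, 0 ≤ mu i) (h1 : ∀ i, mu i ≤ 1) (I : (d : ℕ) → Finset (Fin d)) {C p : ℝ}
    (hC : 0 < C) (hp : 0 < p)
    (h : TractabilityBound (fun ε d => infoComplexity (symProblem S (I d)) ε) C p 0)
    {i₀ i₁ : ι} (hi : i₀ ≠ i₁) (hi₀ : mu i₀ = 1) : mu i₁ < 1 := by
  refine lt_of_le_of_ne (h1 i₁) fun hi₁ => ?_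
  set D := C * 2 ^ (p / 2) * 2 with hD
  obtain ⟨d, hd⟩ := exists_nat_ge (Real.log D / Real.log 2 + D)
  have hb := one_add_rpow_pow_le_of_tractabilityBound b S mu hself hne h0 h1 I hC hp h hi hi₀
    (d := d + 1) (by omega)
  rw [hi₁, Real.one_rpow, Real.rpow_zero, mul_one, one_add_one_eq_two] at hb
  have hb' := sub_card_le_of_pow_le one_lt_two hb
  have hc := card_add_one_le b S mu hself hne h0 h1 hC.le hp (I (d + 1)) (fun ε hε hε1 => by
    simpa using h (d + 1) (by omega) ε hε hε1) hi hi₀ hi₁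
  rw [← hD] at hb' hc
  push_cast at hb'
  linarith

end Tractability

end TensorProblem

end

/-! ### The characterizations of both kinds of tractability. -/

theorem mainTheorem2 {H G : Type*}
    [NormedAddCommGroup H] [InnerProductSpace ℝ H] [CompleteSpace H]
    [NormedAddCommGroup G] [InnerProductSpace ℝ G] [CompleteSpace G]
    (S : H →L[ℝ] G) (hS : IsCompactOperator S)
    (lam : ℕ → ℝ) (hlam : TensorProblem.IsEigenvalueSeq (S.adjoint ∘L S) lam)
    (I : (d : ℕ) → Finset (Fin d)) (hI : ∀ d, 1 < d → (I d).Nonempty)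
    (hlam_one : lam 0 ≤ 1) (hlam_two : 0 < lam 1) :
    (TensorProblem.StronglyPolynomiallyTractable
        (fun ε d => TensorProblem.infoComplexity (TensorProblem.symProblem S (I d)) ε) ↔
      (∃ τ : ℝ, 0 < τ ∧ Summable fun m => lam m ^ τ) ∧
        (lam 0 < 1 ∨
          (lam 0 = 1 ∧ lam 1 < 1 ∧
            (fun d : ℕ => (d : ℝ) - ((I d).card : ℝ)) =O[Filter.atTop] fun _ => (1 : ℝ)))) ∧
    (TensorProblem.PolynomiallyTractable
        (fun ε d => TensorProblem.infoComplexity (TensorProblem.symProblem S (I d)) ε) ↔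
      (∃ τ : ℝ, 0 < τ ∧ Summable fun m => lam m ^ τ) ∧
        (lam 0 < 1 ∨
          (lam 0 = 1 ∧
            (fun d : ℕ => (d : ℝ) - ((I d).card : ℝ)) =O[Filter.atTop]
              fun d : ℕ => Real.log d))) := by
  obtain ⟨ι, b, mu, h0, hself, hne, φ, hφ⟩ := TensorProblem.exists_singular_basis S hS lam hlam
  have hsum_iff {τ : ℝ} (hτ : 0 < τ) :=
    TensorProblem.summable_rpow_iff_of_equiv h0 hlam.nonneg φ hφ hτ
  have hle (i : ι) : mu i ≤ lam 0 := by
    rcases (h0 i).eq_or_lt with h | h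
    · rw [← h]; exact hlam.nonneg 0
    · rw [← hφ ⟨i, h⟩]; exact hlam.antitone (Nat.zero_le _)
  have h1 (i : ι) : mu i ≤ 1 := (hle i).trans hlam_one
  have hpos : 0 < lam 0 := hlam_two.trans_le (hlam.antitone zero_le_one)
  set i₀ : ι := (φ.symm ⟨0, hpos⟩).1 with hi₀
  set i₁ : ι := (φ.symm ⟨1, hlam_two⟩).1 with hi₁
  have hmu₀ : mu i₀ = lam 0 := by rw [hi₀, ← hφ, Equiv.apply_symm_apply]
  have hmu₁ : mu i₁ = lam 1 := by rw [hi₁, ← hφ, Equiv.apply_symm_apply]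
  have hi : i₀ ≠ i₁ := by
    intro h
    have := φ.symm.injective (Subtype.ext h)
    simp at this
  -- An index with eigenvalue `1` corresponds to some `m` with `lam m = 1`, and monotonicity forces
  -- `m = 0`.
  have huniq (h : lam 1 < 1) (i : ι) (hmu : mu i = 1) : i = i₀ := by
    have hmupos : 0 < mu i := by rw [hmu]; exact one_pos
    have hm : (φ ⟨i, hmupos⟩ : ℕ) = 0 := by
      by_contra hm
      have h2 := hlam.antitone (Nat.one_le_iff_ne_zero.2 hm)
      rw [hφ, hmu] at h2
      linarith
    rw [hi₀, show (⟨0, hpos⟩ : {m // 0 < lam m}) = φ ⟨i, hmupos⟩ from Subtype.ext hm.symm,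
      Equiv.symm_apply_apply]
  -- Since `lam 1 > 0`, the base exceeds `1`, so bounds on its powers control `d - #I`.
  have hx (p : ℝ) : 1 < 1 + mu i₁ ^ (p / 2 + 1) := by
    have : 0 < mu i₁ ^ (p / 2 + 1) := Real.rpow_pos_of_pos (hmu₁ ▸ hlam_two) _
    linarith
  have hstrong (h : lam 0 < 1) {τ : ℝ} (hτ : 0 < τ) (hsum : Summable fun m => lam m ^ τ) :=
    TensorProblem.stronglyPolynomiallyTractable_of_lt_one b S mu hself hne h0
      (fun i => (hle i).trans_lt h) i₀ I hτ ((hsum_iff hτ).2 hsum)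
  refine ⟨⟨?_, ?_⟩, ⟨?_, ?_⟩⟩
  · rintro ⟨C, p, hC, hp, h⟩
    refine ⟨⟨p / 2 + 1, by positivity, (hsum_iff (by positivity)).1
      (TensorProblem.summable_of_tractabilityBound b S mu hself hne h0 h1 I hC hp h)⟩, ?_⟩
    refine hlam_one.lt_or_eq.imp id fun hone => ⟨hone, ?_, ?_⟩
    · rw [← hmu₁]
      exact TensorProblem.lt_one_of_tractabilityBound_zero b S mu hself hne h0 h1 I hC hp h hi
        (hmu₀.trans hone)
    · refine TensorProblem.isBigO_one_of_pow_le (hx p) (D := C * 2 ^ (p / 2) * 2) fun d hd => ?_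
      simpa using TensorProblem.one_add_rpow_pow_le_of_tractabilityBound b S mu hself hne h0 h1 I
        hC hp h hi (hmu₀.trans hone) hd
  · rintro ⟨⟨τ, hτ, hsum⟩, h | ⟨-, hlt, hO⟩⟩
    · exact hstrong h hτ hsum
    · exact TensorProblem.stronglyPolynomiallyTractable_of_isBigO_one b S mu hself hne h0 h1 i₀
        (huniq hlt) I hO hτ ((hsum_iff hτ).2 hsum)
  · rintro ⟨C, p, q, hC, hp, -, h⟩
    refine ⟨⟨p / 2 + 1, by positivity, (hsum_iff (by positivity)).1
      (TensorProblem.summable_of_tractabilityBound b S mu hself hne h0 h1 I hC hp h)⟩, ?_⟩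
    refine hlam_one.lt_or_eq.imp id fun hone => ⟨hone, ?_⟩
    refine TensorProblem.isBigO_log_of_pow_le (hx p) (D := C * 2 ^ (p / 2) * 2) (q := q)
      (by positivity)
      fun d hd => ?_
    refine (TensorProblem.one_add_rpow_pow_le_of_tractabilityBound b S mu hself hne h0 h1 I
        hC hp h hi (hmu₀.trans hone) hd).trans (le_of_eq (by ring))
  · rintro ⟨⟨τ, hτ, hsum⟩, h | ⟨-, hO⟩⟩
    · exact (hstrong h hτ hsum).polynomiallyTractable
    · exact TensorProblem.polynomiallyTractable_of_isBigO_log b S mu hself hne h0 h1 i₀ I hO hτ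
        ((hsum_iff hτ).2 hsum)
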